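/- For $h\ge 0$ let $Q_h$ be the $h$-cube: its vertices are the binary strings of length $h$, two strings being adjacent when they differ in exactly one position. For $X\subseteq\{0,1\}^h$ the daisy cube $Q_h(X)$ is the subgraph of $Q_h$ induced by $\{v : v\le x \text{ for some } x\in X\}$, where $\le$ is the coordinatewise order. An isometric embedding of a graph $G$ into $Q_h$ is a map $\alpha:V(G)\to\{0,1\}^h$ with $d_{Q_h}(\alpha(u),\alpha(v))=d_G(u,v)$ for all $u,v\in V(G)$; the isometric dimension of $G$ is the least $h$ for which one exists; and $\alpha$ is proper if moreover $G$ is isomorphic to $Q_h(\alpha(V(G)))$. Theorem. A proper embedding of an unlabeled graph isomorphic to a daisy cube can be found in linear time. That is, there are a single program for the unit-cost random access machine (with addition, truncated subtraction, comparison, bitwise AND, OR and XOR on machine words, and finitely many registers and word arrays) and constants $C,K$ such that the following holds. Let $G$ be a graph with $n$ vertices and $m$ edges that is isomorphic to some daisy cube, let $h$ be its isometric dimension, and let $G$ be given by adjacency lists only (no labels, and $h$ is not given). On every machine whose word length $W$ satisfies $W\ge h$ (so that a label fits into one word) and $2^W\ge K(n+m+1)$, the program halts after at most $C(m+1)$ steps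 and outputs $h$ together with, for each vertex $v$, an $h$-bit word $\alpha(v)$, such that $\alpha$ is a proper embedding of $G$ into $Q_h$. -/

import Mathlib

namespace DaisyCube

/-! ### Hypercubes, daisy cubes and proper embeddings -/

/-- The `h`-cube: binary strings of length `h`, adjacent when their Hamming distance is one. -/
def hypercube (h : ℕ) : SimpleGraph (Fin h → Bool) where
  Adj x y := hammingDist x y = 1
  symm := ⟨fun x y hxy => by rw [hammingDist_comm]; exact hxy⟩
  loopless := ⟨fun x hx => by simp at hx⟩

/-- The daisy cube `Q_h(X)`: the subgraph of the `h`-cube induced by all strings that lie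
coordinatewise below some element of `X`. -/
def daisyCube {h : ℕ} (X : Set (Fin h → Bool)) :
    SimpleGraph {v : Fin h → Bool | ∃ x ∈ X, v ≤ x} :=
  (hypercube h).induce {v : Fin h → Bool | ∃ x ∈ X, v ≤ x}

/-- `G` is isomorphic to a daisy cube. -/
def IsDaisyCube {V : Type*} (G : SimpleGraph V) : Prop :=
  ∃ (k : ℕ) (X : Set (Fin k → Bool)), Nonempty (G ≃g daisyCube X)

/-- Distance-preserving maps from a (connected) graph into the `h`-cube. -/
def IsIsometricEmbedding {V : Type*} (G : SimpleGraph V) {h : ℕ} (α : V → Fin h → Bool) : Prop :=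
  ∀ u v : V, (hypercube h).dist (α u) (α v) = G.dist u v

/-- `h` is the least dimension of a hypercube into which `G` embeds isometrically. -/
def IsIsometricDimension {V : Type*} (G : SimpleGraph V) (h : ℕ) : Prop :=
  IsLeast {k : ℕ | ∃ α : V → Fin k → Bool, IsIsometricEmbedding G α} h

/-- An isometric embedding `α` into the `h`-cube is proper when `G` is isomorphic to the daisy
cube generated by the set of labels that `α` assigns. -/
def IsProperEmbedding {V : Type*} (G : SimpleGraph V) {h : ℕ} (α : V → Fin h → Bool) : Prop :=
  IsIsometricEmbedding G α ∧ Nonempty (G ≃g daisyCube (Set.range α))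

/-! ### A random access machine with `W`-bit words and unit cost

A program uses finitely many registers and finitely many arrays of words. Every arithmetic,
bitwise or comparison operation, every literal, register access and array access costs one step,
and so does every assignment and every test. -/

/-- Word operations; `lt` and `eq` return `1` or `0`, and `sub` is truncated subtraction. -/
inductive Op
  | add | sub | and | or | xor | lt | eq

/-- The result of a word operation before reduction modulo `2 ^ W`. -/
def Op.eval : Op → ℕ → ℕ → ℕ
  | .add, a, b => a + b
  | .sub, a, b => a - b
  | .and, a, b => a &&& b
  | .or, a, b => a ||| b
  | .xor, a, b => a ^^^ b
  | .lt, a, b => if a < b then 1 else 0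
  | .eq, a, b => if a = b then 1 else 0

/-- A memory state: the contents `reg x` of register `x` and `arr a i` of cell `i` of array `a`. -/
structure State where
  reg : ℕ → ℕ
  arr : ℕ → ℕ → ℕ

/-- Expressions; register names and array names are fixed in the program text. -/
inductive Expr
  | lit (k : ℕ)
  | reg (x : ℕ)
  | read (a : ℕ) (i : Expr)
  | bin (o : Op) (e f : Expr)

/-- The value of an expression on a machine with word length `W`. -/
def Expr.eval (W : ℕ) (s : State) : Expr → ℕ
  | .lit k => k % 2 ^ W
  | .reg x => s.reg x
  | .read a i => s.arr a (i.eval W s)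
  | .bin o e f => o.eval (e.eval W s) (f.eval W s) % 2 ^ W

/-- The number of steps needed to evaluate an expression. -/
def Expr.cost : Expr → ℕ
  | .lit _ => 1
  | .reg _ => 1
  | .read _ i => i.cost + 1
  | .bin _ e f => e.cost + f.cost + 1

/-- Structured programs. A test succeeds when its expression is nonzero. -/
inductive Prog
  | skip
  | assign (x : ℕ) (e : Expr)
  | store (a : ℕ) (i e : Expr)
  | seq (p q : Prog)
  | cond (e : Expr) (p q : Prog)
  | loop (e : Expr) (p : Prog)

/-- The state after writing `v` to register `x`. -/
def State.setReg (s : State) (x v : ℕ) : State :=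
  { s with reg := Function.update s.reg x v }

/-- The state after writing `v` to cell `i` of array `a`. -/
def State.setArr (s : State) (a i v : ℕ) : State :=
  { s with arr := Function.update s.arr a (Function.update (s.arr a) i v) }

/-- `Exec W p s t s'`: on a machine with word length `W`, the program `p` started in state `s`
halts after exactly `t` steps in state `s'`. -/
inductive Exec (W : ℕ) : Prog → State → ℕ → State → Prop
  | skip (s : State) : Exec W .skip s 1 s
  | assign (x : ℕ) (e : Expr) (s : State) :
      Exec W (.assign x e) s (e.cost + 1) (s.setReg x (e.eval W s))
  | store (a : ℕ) (i e : Expr) (s : State) :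
      Exec W (.store a i e) s (i.cost + e.cost + 1) (s.setArr a (i.eval W s) (e.eval W s))
  | seq {p q : Prog} {s s' s'' : State} {t t' : ℕ} :
      Exec W p s t s' → Exec W q s' t' s'' → Exec W (.seq p q) s (t + t') s''
  | condTrue {e : Expr} {p q : Prog} {s s' : State} {t : ℕ} :
      e.eval W s ≠ 0 → Exec W p s t s' → Exec W (.cond e p q) s (e.cost + 1 + t) s'
  | condFalse {e : Expr} {p q : Prog} {s s' : State} {t : ℕ} :
      e.eval W s = 0 → Exec W q s t s' → Exec W (.cond e p q) s (e.cost + 1 + t) s'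
  | loopDone {e : Expr} {p : Prog} {s : State} :
      e.eval W s = 0 → Exec W (.loop e p) s (e.cost + 1) s
  | loopStep {e : Expr} {p : Prog} {s s' s'' : State} {t t' : ℕ} :
      e.eval W s ≠ 0 → Exec W p s t s' → Exec W (.loop e p) s' t' s'' →
        Exec W (.loop e p) s (e.cost + 1 + t + t') s''

/-! ### Input and output -/

/-- The initial state `s` holds the graph `G` by adjacency lists (in any order) and nothing else:
register `0` holds the number `n` of vertices, and the cells `j` of array `1` with
`arr 0 v ≤ j < arr 0 (v + 1)` list the neighbours of `v`, each exactly once. -/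
structure IsInput {n : ℕ} (G : SimpleGraph (Fin n)) (s : State) : Prop where
  reg_zero : s.reg 0 = n
  reg_other : ∀ x, x ≠ 0 → s.reg x = 0
  start_zero : s.arr 0 0 = 0
  start_mono : ∀ v : Fin n, s.arr 0 v ≤ s.arr 0 (v + 1)
  neighbors : ∀ v : Fin n, Set.BijOn (s.arr 1) (Set.Ico (s.arr 0 v) (s.arr 0 (v + 1)))
    (Fin.val '' G.neighborSet v)
  start_other : ∀ i, n < i → s.arr 0 i = 0
  neighbors_other : ∀ j, s.arr 0 n ≤ j → s.arr 1 j = 0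
  arr_other : ∀ a i, 2 ≤ a → s.arr a i = 0

/-- The labels of length `h` held by array `2`: bit `i` of the word in cell `v` is the `i`-th
coordinate of the label of vertex `v`. -/
def outputLabel (n h : ℕ) (s : State) : Fin n → Fin h → Bool :=
  fun v i => (s.arr 2 v).testBit i

end DaisyCube

/-! Fix a daisy labelling `y`: an injective labelling whose labels form a lower set and in which
adjacency means Hamming distance one. Graph distance is then Hamming distance, so every daisy
labelling with `h` coordinates is a proper embedding, and it suffices to compute one. Once unused
coordinates are dropped, the vertex labelled zero has one neighbour per coordinate, while an
isometric embedding into a cube sends the neighbours of a vertex in distinct directions. Hence `h`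
is the maximum degree.

Let `r` be any vertex of degree `h`. Its label need not be zero, but all `h` directions occur at
`r`, so after a permutation of coordinates the `i`-th entry of its list lies in direction `i`. Now
the relative labels `y w xor y r` are determined by the graph: a neighbour of `r` has a single bit,
and a vertex at distance at least two has the bitwise OR of the labels of its neighbours closer to
`r`. The latter holds because each bit `i` survives in a closer neighbour that differs in another
bit (`exists_closer_of_ne`). Breadth-first search evaluates this recursion.

The relative labels need not form a lower set. In `y` a one can always be cleared, so a vertex that
disagrees with `r` in bit `i` and has no neighbour in direction `i` forces `y r i` to be one; bit
`i` is then inverted back. If there is no such vertex although `y r i` is one, inverting bit `i`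
maps the label set to itself and does no harm (`xor_const`, `recenter`).

Every phase takes constant time per vertex and list entry, and connectedness gives `n ≤ m + 1`. Time
is accounted for by potentials in `Runs.loop`. -/

namespace DaisyCube

/-! ### Daisy labellings: distances, change of coordinates, inversion of bits. -/

section Labellings

variable {V ι : Type*} [DecidableEq ι]

/-- The string `f` with its `i`-th bit inverted. -/
def flipAt (f : ι → Bool) (i : ι) : ι → Bool := Function.update f i (!f i)

theorem flipAt_self (f : ι → Bool) (i : ι) : flipAt f i i = !f i := by simp [flipAt]

theorem flipAt_of_ne (f : ι → Bool) {i j : ι} (hij : j ≠ i) : flipAt f i j = f j := by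
  simp [flipAt, hij]

theorem flipAt_flipAt (f : ι → Bool) (i : ι) : flipAt (flipAt f i) i = f := by
  simp [flipAt]

theorem flipAt_injective (f : ι → Bool) : Function.Injective (flipAt f) := by
  intro i j hij
  by_contra hne
  have h1 := congrFun hij i
  rw [flipAt_self, flipAt_of_ne f hne] at h1
  simp at h1

theorem flipAt_le {f : ι → Bool} {i : ι} (hi : f i = true) : flipAt f i ≤ f := by
  intro j
  by_cases hj : j = i
  · subst hj; simp [flipAt_self, hi]
  · rw [flipAt_of_ne f hj]

variable [Fintype ι]

theorem hammingDist_eq_one_iff {f g : ι → Bool} :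
    hammingDist f g = 1 ↔ ∃ i, g = flipAt f i := by
  unfold hammingDist
  rw [Finset.card_eq_one]
  constructor
  · rintro ⟨a, ha⟩
    refine ⟨a, funext fun i => ?_⟩
    have hi : f i ≠ g i ↔ i = a := by simpa using Finset.ext_iff.1 ha i
    by_cases h : i = a
    · subst h
      rw [flipAt_self]
      have := hi.2 rfl
      revert this; cases f i <;> cases g i <;> simp
    · rw [flipAt_of_ne f h]
      by_contra h'
      exact h (hi.1 (Ne.symm h'))
  · rintro ⟨a, rfl⟩
    refine ⟨a, ?_⟩
    ext i
    by_cases h : i = a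
    · subst h; simp [flipAt_self]
    · simp [flipAt_of_ne f h, h]

/-- Inverting a bit in which `f` and `g` differ decreases their distance by one. -/
theorem hammingDist_flipAt {f g : ι → Bool} {i : ι} (hi : f i ≠ g i) :
    hammingDist (flipAt f i) g + 1 = hammingDist f g := by
  unfold hammingDist
  rw [← Finset.card_erase_add_one (s := {j | f j ≠ g j}) (a := i) (by simpa using hi)]
  congr 2
  ext j
  by_cases h : j = i
  · subst h
    simp only [flipAt_self, Finset.mem_filter, Finset.mem_univ, true_and, Finset.mem_erase]
    revert hi; cases f j <;> cases g j <;> simp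
  · simp [flipAt_of_ne f h, h]

/-- A labelling of the vertices of `G` that identifies `G` with the subgraph of a hypercube
induced by a lower set. -/
structure IsDaisyLabelling (G : SimpleGraph V) (y : V → ι → Bool) : Prop where
  injective : Function.Injective y
  adj_iff : ∀ u v, G.Adj u v ↔ hammingDist (y u) (y v) = 1
  lower : IsLowerSet (Set.range y)

variable {G : SimpleGraph V} {y : V → ι → Bool}

theorem IsDaisyLabelling.adj_of_eq_flipAt (hy : IsDaisyLabelling G y) {u v : V} {i : ι}
    (h : y v = flipAt (y u) i) : G.Adj u v :=
  (hy.adj_iff u v).2 (hammingDist_eq_one_iff.2 ⟨i, h⟩)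

theorem IsDaisyLabelling.exists_eq_flipAt (hy : IsDaisyLabelling G y) {u v : V}
    (h : G.Adj u v) : ∃ i, y v = flipAt (y u) i :=
  hammingDist_eq_one_iff.1 ((hy.adj_iff u v).1 h)

/-- Where two labels differ, one of them has a one; clearing it stays in the lower set and brings
the labels closer. If the one belongs to the far end, the walk is built from there and reversed. -/
theorem IsDaisyLabelling.exists_walk (hy : IsDaisyLabelling G y) (k : ℕ) :
    ∀ u v : V, hammingDist (y u) (y v) = k → ∃ p : G.Walk u v, p.length = k := by
  induction k with
  | zero =>
    intro u v h
    obtain rfl := hy.injective (eq_of_hammingDist_eq_zero h)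
    exact ⟨.nil, rfl⟩
  | succ k ih =>
    have step : ∀ u v : V, hammingDist (y u) (y v) = k + 1 → ∀ i, y u i = true →
        y v i = false → ∃ p : G.Walk u v, p.length = k + 1 := by
      intro u v h i hu hv
      obtain ⟨u', hu'⟩ := hy.lower (flipAt_le hu) ⟨u, rfl⟩
      have hd : hammingDist (y u') (y v) = k := by
        have := hammingDist_flipAt (f := y u) (g := y v) (i := i) (by simp [hu, hv])
        rw [hu']; omega
      obtain ⟨p, hp⟩ := ih u' v hd
      exact ⟨.cons (hy.adj_of_eq_flipAt hu') p, by simp [hp]⟩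
    intro u v h
    obtain ⟨i, hi⟩ : ∃ i, y u i ≠ y v i := by
      by_contra! hne
      rw [funext hne, hammingDist_self] at h
      omega
    cases hu : y u i
    · have hv : y v i = true := by
        rw [hu] at hi; revert hi; cases y v i <;> simp
      obtain ⟨p, hp⟩ := step v u (by rw [hammingDist_comm]; exact h) i hv hu
      exact ⟨p.reverse, by simpa using hp⟩
    · have hv : y v i = false := by
        rw [hu] at hi; revert hi; cases y v i <;> simp
      exact step u v h i hu hv

set_option linter.unusedSectionVars false in
theorem IsDaisyLabelling.hammingDist_le_length (hy : IsDaisyLabelling G y) {u v : V}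
    (p : G.Walk u v) : hammingDist (y u) (y v) ≤ p.length := by
  induction p with
  | nil => simp
  | @cons u v w h p ih =>
    have h1 := (hy.adj_iff u v).1 h
    have := hammingDist_triangle (y u) (y v) (y w)
    simp only [SimpleGraph.Walk.length_cons]
    omega

/-- Daisy labellings preserve distances. -/
theorem IsDaisyLabelling.dist_eq (hy : IsDaisyLabelling G y) (u v : V) :
    G.dist u v = hammingDist (y u) (y v) := by
  obtain ⟨p, hp⟩ := hy.exists_walk _ u v rfl
  apply le_antisymm
  · rw [← hp]; exact SimpleGraph.dist_le p
  · obtain ⟨q, hq⟩ := p.reachable.exists_walk_length_eq_dist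
    rw [← hq]; exact hy.hammingDist_le_length q

/-- Coordinates outside the range of `c` vanish on all labels, so omitting them changes no distance.
This serves both to discard unused coordinates and to permute the used ones. -/
theorem IsDaisyLabelling.reindex {κ : Type*} [Fintype κ] [DecidableEq κ]
    (hy : IsDaisyLabelling G y) (c : κ → ι) (hc : Function.Injective c)
    (hused : ∀ v i, y v i = true → i ∈ Set.range c) :
    IsDaisyLabelling G (fun v k => y v (c k)) := by
  have hoff : ∀ v i, i ∉ Set.range c → y v i = false := by
    intro v i hi
    by_contra h
    exact hi (hused v i (by simpa using h))
  have hd : ∀ u v, hammingDist (fun k => y u (c k)) (fun k => y v (c k))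
      = hammingDist (y u) (y v) := by
    intro u v
    unfold hammingDist
    rw [← Finset.card_map ⟨c, hc⟩]
    congr 1
    ext i
    simp only [Finset.mem_map, Finset.mem_filter, Finset.mem_univ, true_and,
      Function.Embedding.coeFn_mk]
    constructor
    · rintro ⟨k, hk, rfl⟩; exact hk
    · intro hi
      by_cases hr : i ∈ Set.range c
      · obtain ⟨k, rfl⟩ := hr; exact ⟨k, hi, rfl⟩
      · rw [hoff u i hr, hoff v i hr] at hi; exact absurd rfl hi
  refine ⟨fun u v huv => hy.injective ?_, fun u v => by rw [hd, hy.adj_iff], ?_⟩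
  · have huv' : (fun k => y u (c k)) = (fun k => y v (c k)) := huv
    exact eq_of_hammingDist_eq_zero (by rw [← hd, huv', hammingDist_self])
  · rintro _ b hb ⟨v, rfl⟩
    have hle : Function.extend c b (fun _ => false) ≤ y v := by
      intro i
      by_cases hr : i ∈ Set.range c
      · obtain ⟨k, rfl⟩ := hr
        rw [hc.extend_apply]; exact hb k
      · rw [Function.extend_apply' _ _ _ (by simpa using hr)]; exact Bool.false_le _
    obtain ⟨w, hw⟩ := hy.lower hle ⟨v, rfl⟩
    exact ⟨w, funext fun k => by simp only [hw, hc.extend_apply]⟩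

/-- Inverting bits whose inversion preserves the set of labels yields another daisy labelling. -/
theorem IsDaisyLabelling.xor_const (hy : IsDaisyLabelling G y) (S : ι → Bool)
    (hS : ∀ v i, S i = true → flipAt (y v) i ∈ Set.range y) :
    IsDaisyLabelling G (fun v i => xor (y v i) (S i)) := by
  have hd : ∀ u v, hammingDist (fun i => xor (y u i) (S i)) (fun i => xor (y v i) (S i))
      = hammingDist (y u) (y v) := by
    intro u v
    unfold hammingDist
    congr 1
    ext i
    simp
  -- The bits are inverted one coordinate at a time; `T` holds the coordinates already treated.
  have hmem : ∀ (T : Finset ι) (f : ι → Bool), f ∈ Set.range y →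
      (fun i => xor (f i) (S i && decide (i ∈ T))) ∈ Set.range y := by
    intro T
    induction T using Finset.induction_on with
    | empty => intro f hf; simpa using hf
    | insert a T ha ih =>
      intro f hf
      have h1 := ih f hf
      cases hSa : S a
      · convert h1 using 1
        funext i
        by_cases h : i = a
        · subst h; simp [hSa]
        · simp [h]
      · obtain ⟨v, hv⟩ := h1
        have h2 := hS v a hSa
        convert h2 using 1
        funext i
        by_cases h : i = a
        · subst h; rw [flipAt_self, hv]; simp [hSa, ha]
        · rw [flipAt_of_ne _ h, hv]; simp [h]
  have hmem' : ∀ f ∈ Set.range y, (fun i => xor (f i) (S i)) ∈ Set.range y := by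
    intro f hf
    simpa using hmem Finset.univ f hf
  refine ⟨fun u v huv => hy.injective ?_, fun u v => by rw [hd, hy.adj_iff], ?_⟩
  · have huv' : (fun i => xor (y u i) (S i)) = (fun i => xor (y v i) (S i)) := huv
    exact eq_of_hammingDist_eq_zero (by rw [← hd, huv', hammingDist_self])
  · rintro _ b hb ⟨v, rfl⟩
    obtain ⟨w, hw⟩ := hmem' b (hy.lower hb (hmem' _ ⟨v, rfl⟩))
    exact ⟨w, funext fun i => by simp [hw]⟩

end Labellings

/-! ### Proper embeddings and the isometric dimension as maximum degree. -/

section Cubes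

variable {V : Type*} {G : SimpleGraph V} {h : ℕ}

/-- The full cube labels itself, so its distance formula is a case of `IsDaisyLabelling.dist_eq`. -/
theorem isDaisyLabelling_id : IsDaisyLabelling (hypercube h) (id : (Fin h → Bool) → _) :=
  ⟨Function.injective_id, fun _ _ => Iff.rfl, by simpa using isLowerSet_univ⟩

theorem hypercube_dist (x y : Fin h → Bool) : (hypercube h).dist x y = hammingDist x y :=
  isDaisyLabelling_id.dist_eq x y

theorem IsDaisyLabelling.isIsometricEmbedding {y : V → Fin h → Bool}
    (hy : IsDaisyLabelling G y) : IsIsometricEmbedding G y := fun u v => by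
  rw [hypercube_dist, hy.dist_eq]

/-- The label set is already a lower set, so the daisy cube it generates has no further vertices. -/
theorem IsDaisyLabelling.isProperEmbedding {y : V → Fin h → Bool}
    (hy : IsDaisyLabelling G y) : IsProperEmbedding G y := by
  refine ⟨hy.isIsometricEmbedding, ⟨⟨Equiv.ofBijective
    (fun v => ⟨y v, y v, ⟨v, rfl⟩, le_rfl⟩) ⟨?_, ?_⟩, ?_⟩⟩⟩
  · intro u v huv
    exact hy.injective (congrArg Subtype.val huv)
  · rintro ⟨f, x, hx, hf⟩
    obtain ⟨v, hv⟩ := hy.lower hf hx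
    exact ⟨v, Subtype.ext hv⟩
  · intro u v
    exact (hy.adj_iff u v).symm

theorem IsDaisyCube.exists_isDaisyLabelling (hG : IsDaisyCube G) :
    ∃ (k : ℕ) (y : V → Fin k → Bool), IsDaisyLabelling G y := by
  obtain ⟨k, X, ⟨e⟩⟩ := hG
  refine ⟨k, fun v => (e v).1, fun u v huv => e.injective (Subtype.ext huv), fun u v => ?_, ?_⟩
  · rw [← e.map_adj_iff]; rfl
  · rintro _ b hb ⟨v, rfl⟩
    obtain ⟨x, hx, hv⟩ := (e v).2
    exact ⟨e.symm ⟨b, x, hx, hb.trans hv⟩, by simp⟩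

/-- The neighbours of `v` use pairwise distinct directions at `α v`. Reachability is needed for
injectivity of `α`, since `dist` is `0` between components. -/
theorem IsIsometricEmbedding.card_le {α : V → Fin h → Bool} (hα : IsIsometricEmbedding G α)
    {κ : Type*} [Fintype κ] (v : V) (f : κ → V) (hf : Function.Injective f)
    (hadj : ∀ k, G.Adj v (f k)) (hconn : ∀ u w, G.Reachable u w) : Fintype.card κ ≤ h := by
  have hinj : Function.Injective α := by
    intro u w huw
    have h0 := hα u w
    rw [hypercube_dist, huw, hammingDist_self] at h0
    exact (hconn u w).dist_eq_zero_iff.1 h0.symm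
  have hflip : ∀ k, ∃ i, α (f k) = flipAt (α v) i := by
    intro k
    rw [← hammingDist_eq_one_iff, ← hypercube_dist, hα]
    exact SimpleGraph.dist_eq_one_iff_adj.2 (hadj k)
  choose g hg using hflip
  have hgi : Function.Injective g := by
    intro a b hab
    apply hf; apply hinj
    rw [hg, hg, hab]
  simpa using Fintype.card_le_of_injective g hgi

/-- A daisy cube has a daisy labelling by strings of length its isometric dimension; if the
graph is nonempty, this dimension is the maximum degree. -/
theorem exists_isDaisyLabelling_of_isIsometricDimension [Nonempty V] (hG : IsDaisyCube G)
    (hh : IsIsometricDimension G h) :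
    ∃ y : V → Fin h → Bool, IsDaisyLabelling G y ∧
      (∃ (v : V) (f : Fin h → V), Function.Injective f ∧ ∀ k, G.Adj v (f k)) ∧
      ∀ (v : V) (d : ℕ) (f : Fin d → V), Function.Injective f → (∀ k, G.Adj v (f k)) → d ≤ h := by
  classical
  obtain ⟨k, x, hx⟩ := hG.exists_isDaisyLabelling
  set U : Finset (Fin k) := Finset.univ.filter fun i => ∃ v, x v i = true with hU
  let c : Fin U.card → Fin k := fun j => (U.equivFin.symm j).1
  have hc : Function.Injective c := fun a b hab =>
    U.equivFin.symm.injective (Subtype.ext hab)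
  have hrange : ∀ i, i ∈ Set.range c ↔ ∃ v, x v i = true := by
    intro i
    constructor
    · rintro ⟨j, rfl⟩
      have hm : c j ∈ U := (U.equivFin.symm j).2
      exact (Finset.mem_filter.1 hm).2
    · intro hi
      exact ⟨U.equivFin ⟨i, by simpa [hU] using hi⟩, by simp [c]⟩
  have hy := hx.reindex c hc (fun v i hi => (hrange i).2 ⟨v, hi⟩)
  have hconn : ∀ u w, G.Reachable u w := fun u w => by
    obtain ⟨p, -⟩ := hx.exists_walk _ u w rfl
    exact p.reachable
  -- All unit strings are labels because every kept coordinate is used, so the vertex labelled zero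
  -- has `U.card` neighbours. This yields `U.card ≤ h`; minimality of `h` yields the converse.
  obtain ⟨v₀, hv₀⟩ : (fun _ => false) ∈ Set.range (fun v j => x v (c j)) :=
    hy.lower (fun j => Bool.false_le _) ⟨Classical.arbitrary V, rfl⟩
  have hsingle : ∀ j, flipAt (fun _ => false) j ∈ Set.range (fun v j => x v (c j)) := by
    intro j
    obtain ⟨v, hv⟩ := (hrange (c j)).1 ⟨j, rfl⟩
    refine hy.lower ?_ ⟨v, rfl⟩
    intro i
    by_cases hij : i = j
    · subst hij; simp [hv]
    · rw [flipAt_of_ne _ hij]; exact Bool.false_le _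
  choose f hf using hsingle
  have hfi : Function.Injective f := by
    intro a b hab
    apply flipAt_injective (fun _ => false)
    rw [← hf, ← hf, hab]
  have hfa : ∀ j, G.Adj v₀ (f j) := fun j => by
    refine hy.adj_of_eq_flipAt (i := j) ?_
    exact (hf j).trans (congrArg (flipAt · j) hv₀.symm)
  obtain ⟨α, hα⟩ := hh.1
  have hle : U.card ≤ h := by
    simpa using hα.card_le v₀ f hfi hfa hconn
  have hge : h ≤ U.card := hh.2 ⟨_, hy.isIsometricEmbedding⟩
  obtain rfl : h = U.card := le_antisymm hge hle
  exact ⟨_, hy, ⟨v₀, f, hfi, hfa⟩, fun v d g hg hga => by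
    simpa using hα.card_le v g hg hga hconn⟩

end Cubes
end DaisyCube

namespace DaisyCube

/-! ### Labels relative to a vertex at which all directions occur. -/

section Root

variable {V ι : Type*} [DecidableEq ι] [Fintype ι] {G : SimpleGraph V} {y : V → ι → Bool}

/-- If every inversion of one bit of the label of `r` is a label, then a vertex at distance at
least two from `r` has a neighbour closer to `r` in a direction other than a given one. -/
theorem IsDaisyLabelling.exists_closer_of_ne (hy : IsDaisyLabelling G y) {r : V}
    (hr : ∀ i, flipAt (y r) i ∈ Set.range y) {w : V} {j : ι}
    (hd : 2 ≤ hammingDist (y w) (y r)) :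
    ∃ u i, i ≠ j ∧ y w i ≠ y r i ∧ y u = flipAt (y w) i := by
  by_cases hB : ∃ i, i ≠ j ∧ y w i = true ∧ y r i = false
  · obtain ⟨i, hij, hwi, hri⟩ := hB
    obtain ⟨u, hu⟩ := hy.lower (flipAt_le hwi) ⟨w, rfl⟩
    exact ⟨u, i, hij, by simp [hwi, hri], hu⟩
  push Not at hB
  obtain ⟨i, hi, hij⟩ : ∃ i ∈ Finset.univ.filter (fun i => y w i ≠ y r i), i ≠ j :=
    Finset.exists_mem_ne (lt_of_lt_of_le one_lt_two hd) j
  have hi' : y w i ≠ y r i := by simpa using hi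
  have hwi : y w i = false := by
    cases h : y w i
    · rfl
    · have h2 := hB i hij h
      rw [h] at hi'
      exact absurd (by simpa using h2) (Ne.symm hi')
  have hri : y r i = true := by
    rw [hwi] at hi'; simpa using hi'.symm
  -- Here `w` lies below `r` outside `j`, so bit `i` has to be raised. The result lies below the
  -- label of `r` with bit `j` set to one, which is a label: it is `y r` itself or its inversion at
  -- `j`.
  have key : ∀ f : ι → Bool, f j = true → (∀ k, k ≠ j → f k = y r k) → flipAt (y w) i ≤ f := by
    intro f hf hfr k
    by_cases hkj : k = j
    · subst hkj; rw [hf]; exact Bool.le_true _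
    by_cases hki : k = i
    · subst hki; rw [hfr k hkj, hri]; exact Bool.le_true _
    · rw [flipAt_of_ne _ hki, hfr k hkj]
      cases h : y w k
      · exact Bool.false_le _
      · have := hB k hkj h
        rw [Bool.eq_true_of_not_eq_false this]
  cases hrj : y r j
  · obtain ⟨u, hu⟩ := hy.lower (key (flipAt (y r) j) (by rw [flipAt_self, hrj]; rfl)
      (fun k hk => flipAt_of_ne _ hk)) (hr j)
    exact ⟨u, i, hij, hi', hu⟩
  · obtain ⟨u, hu⟩ := hy.lower (key (y r) hrj (fun _ _ => rfl)) ⟨r, rfl⟩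
    exact ⟨u, i, hij, hi', hu⟩

theorem IsDaisyLabelling.exists_closer (hy : IsDaisyLabelling G y) {r : V}
    (hr : ∀ i, flipAt (y r) i ∈ Set.range y) {w : V} (hd : hammingDist (y w) (y r) ≠ 0) :
    ∃ u i, y w i ≠ y r i ∧ y u = flipAt (y w) i := by
  by_cases h1 : hammingDist (y w) (y r) = 1
  · obtain ⟨i, hi⟩ := hammingDist_eq_one_iff.1 h1
    refine ⟨r, i, ?_, hi⟩
    rw [hi, flipAt_self]; simp
  · obtain ⟨j, -⟩ := Function.ne_iff.1 (hammingDist_ne_zero.1 hd)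
    obtain ⟨u, i, -, h⟩ := hy.exists_closer_of_ne hr (j := j) (w := w) (by omega)
    exact ⟨u, i, h⟩

/-- Labels relative to a vertex `r` become a daisy labelling when the bits are inverted in which
some vertex that disagrees with `r` has no neighbour. -/
theorem IsDaisyLabelling.recenter (hy : IsDaisyLabelling G y) (r : V) (B : ι → Bool)
    (hB : ∀ i, B i = true ↔ ∃ w, y w i ≠ y r i ∧ ¬ ∃ u, G.Adj w u ∧ y u i ≠ y w i) :
    IsDaisyLabelling G (fun v i => xor (xor (y v i) (y r i)) (B i)) := by
  have h := hy.xor_const (fun i => xor (y r i) (B i)) ?_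
  · simpa only [Bool.xor_assoc] using h
  -- Relative to `y`, the bits inverted are those where `y r` and `B` differ. Clearing a bit never
  -- leaves the label set, so only the raising of a zero is at stake.
  intro v i hS
  cases hv : y v i
  swap
  · exact hy.lower (flipAt_le hv) ⟨v, rfl⟩
  -- If `B i` is false, `r` has a one at `i`, so `v` disagrees with `r` and therefore has a
  -- neighbour across `i`. If `B i` is true, `r` has a zero, the witness has a one, and clearing it
  -- produces the neighbour that should not exist.
  cases hBi : B i
  · have hri : y r i = true := by simpa [hBi] using hS
    have hno : ¬ ∃ w, y w i ≠ y r i ∧ ¬ ∃ u, G.Adj w u ∧ y u i ≠ y w i := by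
      rw [← hB, hBi]; simp
    push Not at hno
    obtain ⟨u, hu, hui⟩ := hno v (by simp [hv, hri])
    obtain ⟨k, hk⟩ := hy.exists_eq_flipAt hu
    by_cases hik : i = k
    · subst hik; exact ⟨u, hk⟩
    · rw [hk, flipAt_of_ne _ hik] at hui; exact absurd rfl hui
  · have hri : y r i = false := by simpa [hBi] using hS
    obtain ⟨w, hw, hno⟩ := (hB i).1 hBi
    have hwi : y w i = true := by rw [hri] at hw; simpa using hw
    obtain ⟨u, hu⟩ := hy.lower (flipAt_le hwi) ⟨w, rfl⟩
    exact absurd ⟨u, hy.adj_of_eq_flipAt hu, by rw [hu, flipAt_self]; simp⟩ hno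

end Root

/-! ### Propagation of relative labels along adjacency lists. -/

/-- Adjacency lists with row starts `st` and entries `nb`, of a graph with vertices below `n`. -/
structure AdjLists (n : ℕ) (st nb : ℕ → ℕ) : Prop where
  start_zero : st 0 = 0
  start_mono : ∀ v < n, st v ≤ st (v + 1)
  entry_lt : ∀ v < n, ∀ j, st v ≤ j → j < st (v + 1) → nb j < n

/-- `Lists st nb u w`: the vertex `w` occurs in the adjacency list of `u`. -/
def Lists (st nb : ℕ → ℕ) (u w : ℕ) : Prop := ∃ j, st u ≤ j ∧ j < st (u + 1) ∧ nb j = w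

/-- Distances `d` from `r` and labels `l` (sets of directions as bit masks) that are determined
by propagation along adjacency lists from `r`. -/
structure Propagates (n h : ℕ) (st nb : ℕ → ℕ) (r : ℕ) (l d : ℕ → ℕ) : Prop where
  root_lt : r < n
  root_dist : d r = 0
  label_lt : ∀ w < n, l w < 2 ^ h
  dist_le : ∀ w < n, d w ≤ h
  eq_root : ∀ w < n, d w = 0 → w = r
  dist_step : ∀ u < n, ∀ w, Lists st nb u w → d w ≤ d u + 1
  label_mono : ∀ u < n, ∀ w, Lists st nb u w → d w = d u + 1 →
    ∀ i, (l u).testBit i → (l w).testBit i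
  parent : ∀ w < n, d w ≠ 0 → ∃ u < n, Lists st nb u w ∧ d w = d u + 1
  bit_origin : ∀ w < n, ∀ i, (l w).testBit i → (i < h ∧ nb (st r + i) = w) ∨
    ∃ u < n, Lists st nb u w ∧ d w = d u + 1 ∧ (l u).testBit i
  root_neighbor : ∀ i < h, (l (nb (st r + i))).testBit i

section Relative

variable {n h : ℕ} {G : SimpleGraph (Fin n)} {y : Fin n → Fin h → Bool} {st nb : ℕ → ℕ}

/-- The label of `w` relative to `r` as a bit mask. -/
def relLabel (y : Fin n → Fin h → Bool) (r : Fin n) (w : ℕ) : ℕ :=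
  if hw : w < n then Nat.ofBits fun i => xor (y ⟨w, hw⟩ i) (y r i) else 0

/-- The distance of the labels of `w` and `r`. -/
def relDist (y : Fin n → Fin h → Bool) (r : Fin n) (w : ℕ) : ℕ :=
  if hw : w < n then hammingDist (y ⟨w, hw⟩) (y r) else 0

theorem relDist_val (r w : Fin n) : relDist y r w = hammingDist (y w) (y r) := by
  simp [relDist]

theorem testBit_relLabel (r w : Fin n) (i : Fin h) :
    (relLabel y r w).testBit i = xor (y w i) (y r i) := by
  simp [relLabel]

theorem testBit_relLabel_iff (r w : Fin n) (i : ℕ) :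
    (relLabel y r w).testBit i = true ↔ ∃ hi : i < h, y w ⟨i, hi⟩ ≠ y r ⟨i, hi⟩ := by
  by_cases hi : i < h
  · have := testBit_relLabel (y := y) r w ⟨i, hi⟩
    simp only at this
    rw [this]
    simp [hi]
  · simp [relLabel, hi, Nat.testBit_ofBits_ge _ _ (not_lt.1 hi)]

theorem IsDaisyLabelling.propagates (hy : IsDaisyLabelling G y)
    (hadj : ∀ u w : Fin n, G.Adj u w ↔ Lists st nb u w)
    (hlt : ∀ u : Fin n, ∀ w, Lists st nb u w → w < n)
    (r : Fin n) (hroot : ∀ i : Fin h, ∃ w : Fin n, nb (st r + i) = w ∧ y w = flipAt (y r) i) :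
    Propagates n h st nb r (relLabel y r) (relDist y r) := by
  have hr : ∀ i, flipAt (y r) i ∈ Set.range y := fun i => by
    obtain ⟨w, -, hw⟩ := hroot i
    exact ⟨w, hw⟩
  have hup : ∀ (w u : Fin n) (i : Fin h), y w i ≠ y r i → y u = flipAt (y w) i →
      Lists st nb u w ∧ relDist y r w = relDist y r u + 1 := by
    intro w u i hi hu
    refine ⟨(hadj u w).1 (hy.adj_of_eq_flipAt hu).symm, ?_⟩
    rw [relDist_val, relDist_val, hu, hammingDist_flipAt hi]
  refine ⟨r.2, by rw [relDist_val, hammingDist_self], ?_, ?_, ?_, ?_, ?_, ?_, ?_, ?_⟩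
  · intro w hw
    simp only [relLabel, hw, dif_pos]
    exact Nat.ofBits_lt_two_pow _
  · intro w hw
    simp only [relDist, hw, dif_pos]
    simpa using hammingDist_le_card_fintype (x := y ⟨w, hw⟩) (y := y r)
  · intro w hw h0
    rw [relDist_val (w := ⟨w, hw⟩)] at h0
    exact congrArg Fin.val (hy.injective (eq_of_hammingDist_eq_zero h0))
  · intro u hu w huw
    have hw := hlt ⟨u, hu⟩ w huw
    have h1 := (hy.adj_iff _ _).1 ((hadj ⟨u, hu⟩ ⟨w, hw⟩).2 huw)
    rw [relDist_val (w := ⟨u, hu⟩), relDist_val (w := ⟨w, hw⟩)]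
    have := hammingDist_triangle (y ⟨w, hw⟩) (y ⟨u, hu⟩) (y r)
    rw [hammingDist_comm (y ⟨w, hw⟩) (y ⟨u, hu⟩), h1] at this
    omega
  · intro u hu w huw hd i hi
    have hw := hlt ⟨u, hu⟩ w huw
    obtain ⟨k, hk⟩ := hy.exists_eq_flipAt ((hadj ⟨u, hu⟩ ⟨w, hw⟩).2 huw)
    rw [testBit_relLabel_iff r ⟨u, hu⟩] at hi
    rw [testBit_relLabel_iff r ⟨w, hw⟩]
    obtain ⟨hih, hi⟩ := hi
    refine ⟨hih, ?_⟩
    -- Changing a bit in which `u` disagrees with `r` would lead closer to `r`, not farther away.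
    by_cases hik : (⟨i, hih⟩ : Fin h) = k
    · subst hik
      rw [relDist_val (w := ⟨u, hu⟩), relDist_val (w := ⟨w, hw⟩), hk] at hd
      have := hammingDist_flipAt hi
      omega
    · rw [hk, flipAt_of_ne _ hik]; exact hi
  · intro w hw hd
    rw [relDist_val (w := ⟨w, hw⟩)] at hd
    obtain ⟨u, i, hi, hu⟩ := hy.exists_closer hr hd
    exact ⟨u, u.2, hup ⟨w, hw⟩ u i hi hu⟩
  · intro w hw i hi
    rw [testBit_relLabel_iff r ⟨w, hw⟩] at hi
    obtain ⟨hih, hi⟩ := hi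
    by_cases h1 : hammingDist (y ⟨w, hw⟩) (y r) = 1
    · left
      refine ⟨hih, ?_⟩
      obtain ⟨k, hk⟩ := hammingDist_eq_one_iff.1 h1
      obtain ⟨w', hw', hy'⟩ := hroot ⟨i, hih⟩
      have hik : (⟨i, hih⟩ : Fin h) = k := by
        by_contra hne
        rw [hk, flipAt_of_ne _ hne] at hi
        exact hi rfl
      have : y w' = y ⟨w, hw⟩ := by rw [hy', hk, ← hik, flipAt_flipAt]
      rw [hw', hy.injective this]
    · right
      have h0 : hammingDist (y ⟨w, hw⟩) (y r) ≠ 0 := by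
        rw [hammingDist_ne_zero]
        intro heq; rw [heq] at hi; exact hi rfl
      -- Avoiding direction `i` gives a closer neighbour that still carries bit `i`.
      obtain ⟨u, k, hk, hwk, hu⟩ := hy.exists_closer_of_ne hr (j := ⟨i, hih⟩) (w := ⟨w, hw⟩)
        (by omega)
      obtain ⟨h2, h3⟩ := hup ⟨w, hw⟩ u k hwk hu
      refine ⟨u, u.2, h2, h3, ?_⟩
      rw [testBit_relLabel_iff]
      exact ⟨hih, by rw [hu, flipAt_of_ne _ (Ne.symm hk)]; exact hi⟩
  · intro i hi
    obtain ⟨w, hw, hyw⟩ := hroot ⟨i, hi⟩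
    simp only at hw
    rw [hw, testBit_relLabel_iff]
    exact ⟨hi, by rw [hyw, flipAt_self]; simp⟩

/-- Bit masks relative to `r`, corrected by the mask `B` of those directions in which some vertex
disagrees with `r` and has no neighbour, are the masks of a daisy labelling. -/
theorem IsDaisyLabelling.recenter_relLabel (hy : IsDaisyLabelling G y)
    (hadj : ∀ u w : Fin n, G.Adj u w ↔ Lists st nb u w)
    (hlt : ∀ u : Fin n, ∀ w, Lists st nb u w → w < n) (r : Fin n) (B : ℕ)
    (hB : ∀ i < h, B.testBit i = true ↔ ∃ w < n, (relLabel y r w).testBit i = true ∧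
      ¬ ∃ u, Lists st nb w u ∧ (relLabel y r w ^^^ relLabel y r u).testBit i = true) :
    IsDaisyLabelling G (fun (v : Fin n) (i : Fin h) => (relLabel y r v ^^^ B).testBit i) := by
  have hx := hy.recenter r (fun i => B.testBit i) ?_
  · simpa only [Nat.testBit_xor, testBit_relLabel] using hx
  intro i
  rw [hB i i.2]
  constructor
  · rintro ⟨w, hw, hwi, hno⟩
    refine ⟨⟨w, hw⟩, ?_, ?_⟩
    · obtain ⟨_, h⟩ := (testBit_relLabel_iff r ⟨w, hw⟩ i).1 hwi
      exact h
    · rintro ⟨u, hu, hui⟩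
      refine hno ⟨u, (hadj _ _).1 hu, ?_⟩
      rw [Nat.testBit_xor, testBit_relLabel r ⟨w, hw⟩, testBit_relLabel]
      revert hui
      cases y u i <;> cases y ⟨w, hw⟩ i <;> cases y r i <;> simp
  · rintro ⟨w, hwi, hno⟩
    refine ⟨w, w.2, (testBit_relLabel_iff r w i).2 ⟨i.2, hwi⟩, ?_⟩
    rintro ⟨u, hu, hui⟩
    have hun := hlt w u hu
    refine hno ⟨⟨u, hun⟩, (hadj _ _).2 hu, ?_⟩
    rw [Nat.testBit_xor, testBit_relLabel r w, testBit_relLabel r ⟨u, hun⟩] at hui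
    revert hui
    cases y ⟨u, hun⟩ i <;> cases y w i <;> cases y r i <;> simp

end Relative
end DaisyCube

namespace DaisyCube

/-! ### Total correctness with time bounds -/

/-- `Runs W p s T Q`: started in `s`, the program `p` halts within `T` steps in a state
satisfying `Q`. -/
def Runs (W : ℕ) (p : Prog) (s : State) (T : ℕ) (Q : State → Prop) : Prop :=
  ∃ t s', Exec W p s t s' ∧ t ≤ T ∧ Q s'

variable {W : ℕ} {s : State} {T T' : ℕ} {Q Q' : State → Prop}

theorem Runs.mono {p : Prog} (h : Runs W p s T Q) (hT : T ≤ T') (hQ : ∀ s', Q s' → Q' s') :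
    Runs W p s T' Q' := by
  obtain ⟨t, s', he, ht, hq⟩ := h
  exact ⟨t, s', he, ht.trans hT, hQ s' hq⟩

theorem Runs.seq {p q : Prog} {R : State → Prop} (hp : Runs W p s T R)
    (hq : ∀ s', R s' → Runs W q s' T' Q) : Runs W (.seq p q) s (T + T') Q := by
  obtain ⟨t, s', he, ht, hr⟩ := hp
  obtain ⟨t', s'', he', ht', hq'⟩ := hq s' hr
  exact ⟨t + t', s'', .seq he he', by omega, hq'⟩

/-- The loop rule: `Φ` bounds the time of the remaining iterations. -/
theorem Runs.loop {e : Expr} {p : Prog} (I : State → Prop) (Φ : State → ℕ)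
    (hI : I s) (hT : Φ s + e.cost + 1 ≤ T)
    (hstep : ∀ s, I s → e.eval W s ≠ 0 →
      ∃ B, Runs W p s B (fun s' => I s' ∧ Φ s' + B + e.cost + 1 ≤ Φ s))
    (hexit : ∀ s, I s → e.eval W s = 0 → Q s) : Runs W (.loop e p) s T Q := by
  suffices H : ∀ k s, Φ s ≤ k → I s → Runs W (.loop e p) s (Φ s + e.cost + 1) Q from
    (H _ s le_rfl hI).mono hT fun _ h => h
  intro k
  induction k with
  | zero =>
    intro s hk hs
    by_cases he : e.eval W s = 0
    · exact ⟨_, s, .loopDone he, by omega, hexit s hs he⟩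
    -- An iteration consumes at least `e.cost + 1` of the potential, so none is possible at
    -- potential zero.
    · obtain ⟨B, t, s', -, -, -, h⟩ := hstep s hs he
      omega
  | succ k ih =>
    intro s hk hs
    by_cases he : e.eval W s = 0
    · exact ⟨_, s, .loopDone he, by omega, hexit s hs he⟩
    · obtain ⟨B, t, s', hx, ht, hs', h⟩ := hstep s hs he
      obtain ⟨t', s'', hx', ht', hq⟩ := ih s' (by omega) hs'
      exact ⟨_, s'', .loopStep he hx hx', by omega, hq⟩

/-- Programs without loops. -/
def Prog.LoopFree : Prog → Prop
  | .skip => True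
  | .assign _ _ => True
  | .store _ _ _ => True
  | .seq p q => p.LoopFree ∧ q.LoopFree
  | .cond _ p q => p.LoopFree ∧ q.LoopFree
  | .loop _ _ => False

/-- The state reached by a program without loops. -/
def Prog.result (W : ℕ) : Prog → State → State
  | .skip, s => s
  | .assign x e, s => s.setReg x (e.eval W s)
  | .store a i e, s => s.setArr a (i.eval W s) (e.eval W s)
  | .seq p q, s => q.result W (p.result W s)
  | .cond e p q, s => if e.eval W s = 0 then q.result W s else p.result W s
  | .loop _ _, s => s

/-- A bound for the running time of a program without loops. -/
def Prog.bound : Prog → ℕ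
  | .skip => 1
  | .assign _ e => e.cost + 1
  | .store _ i e => i.cost + e.cost + 1
  | .seq p q => p.bound + q.bound
  | .cond e p q => e.cost + 1 + p.bound + q.bound
  | .loop _ _ => 0

/-- This reduces straight-line code to evaluating `Prog.result`, which `simp` can do. The time bound
charges both branches of a test. -/
theorem Runs.of_loopFree {p : Prog} (hp : p.LoopFree) (hQ : Q (p.result W s)) :
    Runs W p s p.bound Q := by
  suffices H : ∀ (p : Prog) (s : State), p.LoopFree →
      ∃ t, Exec W p s t (p.result W s) ∧ t ≤ p.bound by
    obtain ⟨t, he, ht⟩ := H p s hp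
    exact ⟨t, _, he, ht, hQ⟩
  intro p
  induction p with
  | skip => exact fun s _ => ⟨_, .skip s, le_rfl⟩
  | assign x e => exact fun s _ => ⟨_, .assign x e s, le_rfl⟩
  | store a i e => exact fun s _ => ⟨_, .store a i e s, le_rfl⟩
  | seq p q ihp ihq =>
    intro s h
    obtain ⟨t, he, ht⟩ := ihp s h.1
    obtain ⟨t', he', ht'⟩ := ihq (p.result W s) h.2
    exact ⟨_, .seq he he', Nat.add_le_add ht ht'⟩
  | cond e p q ihp ihq =>
    intro s h
    simp only [Prog.result, Prog.bound]
    split_ifs with he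
    · obtain ⟨t, hx, ht⟩ := ihq s h.2
      exact ⟨_, .condFalse he hx, by omega⟩
    · obtain ⟨t, hx, ht⟩ := ihp s h.1
      exact ⟨_, .condTrue he hx, by omega⟩
  | loop e p => exact fun s h => h.elim

/-- Splits off the straight-line initialisation; `R` records what it establishes and `T'` is the
time left for the rest. -/
theorem Runs.init {p q : Prog} {R : State → Prop} (T' : ℕ) (hp : p.LoopFree)
    (hR : R (p.result W s)) (hT : p.bound + T' ≤ T) (hq : ∀ s', R s' → Runs W q s' T' Q) :
    Runs W (.seq p q) s T Q :=
  ((Runs.of_loopFree hp hR).seq hq).mono hT fun _ h => h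

theorem State.setReg_reg (s : State) (x v z : ℕ) :
    (s.setReg x v).reg z = if z = x then v else s.reg z := by
  simp [State.setReg, Function.update_apply]

theorem State.setReg_arr (s : State) (x v : ℕ) : (s.setReg x v).arr = s.arr := rfl

theorem State.setArr_reg (s : State) (a i v : ℕ) : (s.setArr a i v).reg = s.reg := rfl

theorem State.setArr_arr (s : State) (a i v b : ℕ) :
    (s.setArr a i v).arr b = if b = a then Function.update (s.arr a) i v else s.arr b := by
  simp [State.setArr, Function.update_apply]

/-- Words of length zero must be excluded, for there the truth value `1` would reduce to `0`. -/
theorem ite_mod_word (hW : 1 < 2 ^ W) (c : Prop) [Decidable c] :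
    (if c then 1 else 0) % 2 ^ W = if c then 1 else 0 := by
  split_ifs
  · exact Nat.mod_eq_of_lt hW
  · simp

theorem eval_lt_ne_zero (hW : 1 < 2 ^ W) (e f : Expr) :
    (Expr.bin .lt e f).eval W s ≠ 0 ↔ e.eval W s < f.eval W s := by
  simp [Expr.eval, Op.eval, ite_mod_word hW]

/-- Adjacency lists whose size fits into words of length `W`. -/
structure WordLists (W n : ℕ) (st nb : ℕ → ℕ) : Prop extends AdjLists n st nb where
  one_lt : 1 < 2 ^ W
  size_lt : n + 1 < 2 ^ W
  start_lt : st n + 1 < 2 ^ W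

theorem AdjLists.start_le {n : ℕ} {st nb : ℕ → ℕ} (L : AdjLists n st nb) {v w : ℕ} (hvw : v ≤ w)
    (hw : w ≤ n) : st v ≤ st w := by
  induction w, hvw using Nat.le_induction with
  | base => exact le_rfl
  | succ w hvw ih => exact (ih (by omega)).trans (L.start_mono w (by omega))

theorem WordLists.start_lt_of_le {n : ℕ} {st nb : ℕ → ℕ} (L : WordLists W n st nb) {v : ℕ}
    (hv : v ≤ n) : st v + 1 < 2 ^ W :=
  lt_of_le_of_lt (Nat.add_le_add_right (L.start_le hv le_rfl) 1) L.start_lt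

/-! ### A vertex of maximum degree -/

/-- The degree of the vertex in register `3`. -/
def degreeExpr : Expr :=
  .bin .sub (.read 0 (.bin .add (.reg 3) (.lit 1))) (.read 0 (.reg 3))

/-- One step of the search for a vertex of maximum degree. -/
def maxDegreeBody : Prog :=
  .seq (.cond (.bin .lt (.reg 1) degreeExpr) (.seq (.assign 1 degreeExpr) (.assign 2 (.reg 3)))
    .skip) (.assign 3 (.bin .add (.reg 3) (.lit 1)))

/-- Writes the maximum degree to register `1` and a vertex of this degree to register `2`. -/
def maxDegree : Prog :=
  .seq (.seq (.assign 3 (.lit 0)) (.seq (.assign 1 degreeExpr) (.assign 2 (.lit 0))))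
    (.loop (.bin .lt (.reg 3) (.reg 0)) maxDegreeBody)

variable {n : ℕ} {st nb : ℕ → ℕ}

theorem runs_maxDegreeBody (L : WordLists W n st nb) (h3 : s.reg 3 < n) (hst : s.arr 0 = st) :
    Runs W maxDegreeBody s 50 fun s' => s'.arr = s.arr ∧ s'.reg 0 = s.reg 0 ∧
      s'.reg 3 = s.reg 3 + 1 ∧
      s'.reg 1 = (if s.reg 1 < st (s.reg 3 + 1) - st (s.reg 3) then
        st (s.reg 3 + 1) - st (s.reg 3) else s.reg 1) ∧
      s'.reg 2 = (if s.reg 1 < st (s.reg 3 + 1) - st (s.reg 3) then s.reg 3 else s.reg 2) := by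
  have h1 : 1 % 2 ^ W = 1 := Nat.mod_eq_of_lt L.one_lt
  have hsub : (st (s.reg 3 + 1) - st (s.reg 3)) % 2 ^ W = st (s.reg 3 + 1) - st (s.reg 3) :=
    Nat.mod_eq_of_lt (by have := L.start_lt_of_le (v := s.reg 3 + 1) h3; omega)
  have hsucc : (s.reg 3 + 1) % 2 ^ W = s.reg 3 + 1 :=
    Nat.mod_eq_of_lt (by have := L.size_lt; omega)
  refine (Runs.of_loopFree (by simp [Prog.LoopFree, maxDegreeBody]) ?_).mono
    (by simp [maxDegreeBody, Prog.bound, degreeExpr, Expr.cost]) fun _ h => h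
  by_cases hc : s.reg 1 < st (s.reg 3 + 1) - st (s.reg 3) <;>
    simp [maxDegreeBody, degreeExpr, Prog.result, Expr.eval, Op.eval, h1, hst, hsucc, hsub, hc,
      State.setReg_reg, State.setReg_arr]

theorem runs_maxDegree (L : WordLists W n st nb) (hn : 0 < n) (h0 : s.reg 0 = n)
    (hst : s.arr 0 = st) :
    Runs W maxDegree s (100 * n + 100) fun s' =>
      s'.arr = s.arr ∧ s'.reg 0 = n ∧ s'.reg 2 < n ∧
      st (s'.reg 2 + 1) - st (s'.reg 2) = s'.reg 1 ∧ ∀ v < n, st (v + 1) - st v ≤ s'.reg 1 := by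
  have h1 : 1 % 2 ^ W = 1 := Nat.mod_eq_of_lt L.one_lt
  have hsub : (st 1 - st 0) % 2 ^ W = st 1 - st 0 :=
    Nat.mod_eq_of_lt (by have := L.start_lt_of_le (v := 1) hn; omega)
  -- Vertex `0` is the first candidate, so register `1` is the degree of register `2` from the
  -- outset; this uses `0 < n`.
  refine Runs.init (60 * n + 30)
    (R := fun s' => s'.arr = s.arr ∧ s'.reg 0 = n ∧ s'.reg 3 = 0 ∧ s'.reg 2 < n ∧
      st (s'.reg 2 + 1) - st (s'.reg 2) = s'.reg 1)
    (by simp [Prog.LoopFree])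
    (by simp [Prog.result, Expr.eval, degreeExpr, Op.eval, State.setReg_reg, State.setReg_arr,
      h0, hst, h1, hn, hsub])
    (by simp [Prog.bound, degreeExpr, Expr.cost]; omega) ?_
  rintro s₁ ⟨ha, h0', h3, h2, hd⟩
  refine Runs.loop (fun s' => s'.arr = s.arr ∧ s'.reg 0 = n ∧ s'.reg 3 ≤ n ∧ s'.reg 2 < n ∧
      st (s'.reg 2 + 1) - st (s'.reg 2) = s'.reg 1 ∧
      ∀ v < s'.reg 3, st (v + 1) - st v ≤ s'.reg 1)
    (fun s' => 60 * (n - s'.reg 3)) ⟨ha, h0', by omega, h2, hd, by simp [h3]⟩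
    (by simp [Expr.cost]; omega) ?_ ?_
  · rintro s₂ ⟨ha, h0', h3, h2, hd, hm⟩ he
    have hlt : s₂.reg 3 < n := h0' ▸ (eval_lt_ne_zero L.one_lt _ _).1 he
    have ha0 : s₂.arr 0 = st := by rw [ha, hst]
    refine ⟨50, (runs_maxDegreeBody L hlt ha0).mono (by omega) ?_⟩
    rintro s₃ ⟨ha', h0'', h3', h1', h2'⟩
    refine ⟨⟨ha'.trans ha, h0''.trans h0', by omega, ?_, ?_, ?_⟩, ?_⟩
    · rw [h2']; split_ifs <;> omega
    · rw [h2', h1']; split_ifs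
      · rfl
      · exact hd
    · intro v hv
      rw [h3', Nat.lt_succ_iff_lt_or_eq] at hv
      rw [h1']
      rcases hv with hv | rfl
      · have := hm v hv; split_ifs <;> omega
      · split_ifs <;> omega
    · simp only [Expr.cost]; omega
  · rintro s₂ ⟨ha, h0', h3, h2, hd, hm⟩ he
    have hlt : ¬ s₂.reg 3 < n := fun h =>
      (eval_lt_ne_zero L.one_lt (.reg 3) (.reg 0)).2 (by rwa [← h0'] at h) he
    exact ⟨ha, h0', h2, hd, fun v hv => hm v (by omega)⟩

end DaisyCube

namespace DaisyCube

variable {W : ℕ} {s : State} {n : ℕ} {st nb : ℕ → ℕ}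

theorem testBit_or_mod (a b i : ℕ) :
    ((a ||| b) % 2 ^ W).testBit i = true ↔ i < W ∧ (a.testBit i = true ∨ b.testBit i = true) := by
  simp [Nat.testBit_mod_two_pow]

theorem lt_of_testBit {a k i : ℕ} (ha : a < 2 ^ k) (hi : a.testBit i = true) : i < k := by
  by_contra h
  rw [Nat.testBit_lt_two_pow (lt_of_lt_of_le ha (Nat.pow_le_pow_right two_pos (not_lt.1 h)))] at hi
  exact absurd hi (by simp)

/-! ### Labels of the neighbours of the root -/

/-- Gives the next direction to the neighbour in cell `reg 4`. -/
def labelRootBody : Prog :=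
  .seq (.store 2 (.read 1 (.reg 4)) (.bin .or (.read 2 (.read 1 (.reg 4))) (.reg 5)))
    (.seq (.assign 6 (.bin .or (.reg 6) (.reg 5)))
      (.seq (.assign 5 (.bin .add (.reg 5) (.reg 5)))
        (.assign 4 (.bin .add (.reg 4) (.lit 1)))))

/-- The end of the adjacency list of the vertex in register `x`. -/
def listEnd (x : ℕ) : Expr := .read 0 (.bin .add (.reg x) (.lit 1))

/-- Gives the neighbours of the vertex in register `2` distinct powers of two as labels, and
collects these powers in register `6`. -/
def labelRoot : Prog :=
  .seq (.seq (.assign 5 (.lit 1)) (.seq (.assign 6 (.lit 0)) (.assign 4 (.read 0 (.reg 2)))))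
    (.loop (.bin .lt (.reg 4) (listEnd 2)) labelRootBody)

theorem eval_listEnd (L : WordLists W n st nb) {x : ℕ} (hx : s.reg x < n) (hst : s.arr 0 = st) :
    (listEnd x).eval W s = st (s.reg x + 1) := by
  have h1 : 1 % 2 ^ W = 1 := Nat.mod_eq_of_lt L.one_lt
  have hsucc : (s.reg x + 1) % 2 ^ W = s.reg x + 1 :=
    Nat.mod_eq_of_lt (by have := L.size_lt; omega)
  simp [listEnd, Expr.eval, Op.eval, h1, hsucc, hst]

theorem runs_labelRootBody (hW : 1 < 2 ^ W) (h4 : s.reg 4 + 1 < 2 ^ W) :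
    Runs W labelRootBody s 50 fun s' =>
      (∀ a ≠ 2, s'.arr a = s.arr a) ∧ s'.reg 0 = s.reg 0 ∧ s'.reg 1 = s.reg 1 ∧
      s'.reg 2 = s.reg 2 ∧ s'.reg 4 = s.reg 4 + 1 ∧ s'.reg 5 = (s.reg 5 + s.reg 5) % 2 ^ W ∧
      s'.reg 6 = (s.reg 6 ||| s.reg 5) % 2 ^ W ∧
      s'.arr 2 = Function.update (s.arr 2) (s.arr 1 (s.reg 4))
        ((s.arr 2 (s.arr 1 (s.reg 4)) ||| s.reg 5) % 2 ^ W) := by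
  have h1 : 1 % 2 ^ W = 1 := Nat.mod_eq_of_lt hW
  have hsucc : (s.reg 4 + 1) % 2 ^ W = s.reg 4 + 1 := Nat.mod_eq_of_lt h4
  refine (Runs.of_loopFree (by simp [Prog.LoopFree, labelRootBody]) ?_).mono
    (by simp [labelRootBody, Prog.bound, Expr.cost]) fun _ h => h
  refine ⟨fun a ha => ?_, ?_⟩
  · simp [labelRootBody, Prog.result, State.setReg_arr, State.setArr_arr, ha]
  · simp [labelRootBody, Prog.result, Expr.eval, Op.eval, h1, hsucc,
      State.setReg_reg, State.setReg_arr, State.setArr_arr, State.setArr_reg]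

theorem runs_labelRoot (L : WordLists W n st nb) {r h : ℕ} (hr : r < n) (hh : h ≤ W)
    (hdeg : st (r + 1) = st r + h) (h0 : s.reg 0 = n) (h1 : s.reg 1 = h) (h2 : s.reg 2 = r)
    (hst : s.arr 0 = st) (hnb : s.arr 1 = nb) (hlab : ∀ w, s.arr 2 w = 0) :
    Runs W labelRoot s (100 * h + 100) fun s' =>
      (∀ a ≠ 2, s'.arr a = s.arr a) ∧ s'.reg 0 = n ∧ s'.reg 1 = h ∧ s'.reg 2 = r ∧
      (∀ i, (s'.reg 6).testBit i = true ↔ i < h) ∧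
      ∀ w i, (s'.arr 2 w).testBit i = true ↔ i < h ∧ nb (st r + i) = w := by
  have hlt := L.start_lt_of_le (v := r + 1) hr
  have h1' : 1 % 2 ^ W = 1 := Nat.mod_eq_of_lt L.one_lt
  refine Runs.init (100 * h + 10)
    (R := fun s' => (∀ a, s'.arr a = s.arr a) ∧ s'.reg 0 = n ∧ s'.reg 1 = h ∧ s'.reg 2 = r ∧
      s'.reg 4 = st r ∧ s'.reg 5 = 1 ∧ s'.reg 6 = 0)
    (by simp [Prog.LoopFree])
    (by simp [Prog.result, Expr.eval, State.setReg_reg, State.setReg_arr, h0, h1, h2, hst, h1'])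
    (by simp [Prog.bound, Expr.cost]; omega) ?_
  rintro s₁ ⟨ha, h0, h1, h2, h4, h5, h6⟩
  -- Register `5` is `2 ^ k` only modulo `2 ^ W`: when `h = W`, the doubling after the last
  -- neighbour overflows to zero.
  refine Runs.loop (fun s' => (∀ a ≠ 2, s'.arr a = s.arr a) ∧ s'.reg 0 = n ∧ s'.reg 1 = h ∧
      s'.reg 2 = r ∧ ∃ k ≤ h, s'.reg 4 = st r + k ∧ s'.reg 5 = 2 ^ k % 2 ^ W ∧
      (∀ i, (s'.reg 6).testBit i = true ↔ i < k) ∧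
      ∀ w i, (s'.arr 2 w).testBit i = true ↔ i < k ∧ nb (st r + i) = w)
    (fun s' => 100 * (st r + h - s'.reg 4))
    ⟨fun a _ => ha a, h0, h1, h2, 0, by omega, by omega, by rw [h5, pow_zero, h1'],
      by simp [h6], by simp [ha, hlab]⟩
    (by simp [Expr.cost, listEnd]; omega) ?_ ?_
  · rintro s₂ ⟨ha, h0, h1, h2, k, hk, h4, h5, h6, hb⟩ he
    rw [eval_lt_ne_zero L.one_lt, eval_listEnd L (by omega) (by rw [ha 0 (by simp), hst]), h2,
      hdeg] at he
    simp only [Expr.eval, h4] at he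
    have hkh : k < h := by omega
    have hp : s₂.reg 5 = 2 ^ k := by
      rw [h5]; exact Nat.mod_eq_of_lt (Nat.pow_lt_pow_right one_lt_two (by omega))
    have hbit : ∀ i, (2 ^ k).testBit i = true ↔ k = i := by simp [Nat.testBit_two_pow]
    have hnb' : s₂.arr 1 (s₂.reg 4) = nb (st r + k) := by rw [ha 1 (by simp), hnb, h4]
    refine ⟨50, (runs_labelRootBody L.one_lt (by omega)).mono le_rfl ?_⟩
    rintro s₃ ⟨ha', h0', h1', h2', h4', h5', h6', hl'⟩
    refine ⟨⟨fun a haa => (ha' a haa).trans (ha a haa), by omega, by omega, by omega, k + 1,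
      by omega, by omega, ?_, ?_, ?_⟩, ?_⟩
    · rw [h5', hp, pow_succ, mul_two]
    · intro i
      rw [h6', hp, testBit_or_mod, h6, hbit]
      omega
    · intro w i
      rw [hl', hnb', hp]
      by_cases hw : w = nb (st r + k)
      · subst hw
        rw [Function.update_self, testBit_or_mod, hb, hbit]
        constructor
        · rintro ⟨-, ⟨h1, h2⟩ | rfl⟩
          · exact ⟨by omega, h2⟩
          · exact ⟨by omega, rfl⟩
        · rintro ⟨h1, h2⟩
          refine ⟨by omega, ?_⟩
          rcases Nat.lt_succ_iff_lt_or_eq.1 h1 with h | h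
          · exact Or.inl ⟨h, h2⟩
          · exact Or.inr h.symm
      · rw [Function.update_of_ne hw, hb]
        constructor
        · rintro ⟨h1, h2⟩; exact ⟨by omega, h2⟩
        · rintro ⟨h1, h2⟩
          refine ⟨?_, h2⟩
          rcases Nat.lt_succ_iff_lt_or_eq.1 h1 with h | rfl
          · exact h
          · exact absurd h2.symm hw
    · simp only [Expr.cost, listEnd]; omega
  · rintro s₂ ⟨ha, h0, h1, h2, k, hk, h4, h5, h6, hb⟩ he
    have hkh : k = h := by
      by_contra hne
      refine (eval_lt_ne_zero L.one_lt _ _).2 ?_ he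
      rw [eval_listEnd L (by omega) (by rw [ha 0 (by simp), hst]), h2, hdeg]
      simp only [Expr.eval]; omega
    subst hkh
    exact ⟨ha, h0, h1, h2, h6, hb⟩

/-! ### The directions to be inverted -/

/-- Adds to register `12` the direction of the neighbour in cell `reg 4` of the vertex `reg 3`. -/
def directionBody : Prog :=
  .seq (.assign 12 (.bin .or (.reg 12)
    (.bin .xor (.read 2 (.reg 3)) (.read 2 (.read 1 (.reg 4))))))
    (.assign 4 (.bin .add (.reg 4) (.lit 1)))

/-- Collects the directions of the neighbours of the vertex in register `3`. -/
def directions : Prog :=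
  .seq (.seq (.assign 12 (.lit 0)) (.assign 4 (.read 0 (.reg 3))))
    (.loop (.bin .lt (.reg 4) (listEnd 3)) directionBody)

/-- Adds to register `11` the directions in the label of the vertex in register `3` in which it
has no neighbour. -/
def missingBody : Prog :=
  .seq directions
    (.seq (.assign 11 (.bin .or (.reg 11)
      (.bin .and (.bin .xor (.reg 6) (.reg 12)) (.read 2 (.reg 3)))))
      (.assign 3 (.bin .add (.reg 3) (.lit 1))))

/-- Collects in register `11` the directions in which some vertex whose label has this direction
has no neighbour. -/
def missing : Prog :=
  .seq (.seq (.assign 11 (.lit 0)) (.assign 3 (.lit 0)))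
    (.loop (.bin .lt (.reg 3) (.reg 0)) missingBody)

variable {h : ℕ} {l : ℕ → ℕ}

theorem runs_directions (L : WordLists W n st nb) {v : ℕ} (hv : v < n) (hh : h ≤ W)
    (hl : ∀ w < n, l w < 2 ^ h) (hst : s.arr 0 = st) (hnb : s.arr 1 = nb)
    (hlab : ∀ w < n, s.arr 2 w = l w) (h3 : s.reg 3 = v) :
    Runs W directions s (50 * (st (v + 1) - st v) + 50) fun s' =>
      s'.arr = s.arr ∧ s'.reg 0 = s.reg 0 ∧ s'.reg 1 = s.reg 1 ∧ s'.reg 3 = v ∧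
      s'.reg 6 = s.reg 6 ∧ s'.reg 11 = s.reg 11 ∧
      ∀ i, (s'.reg 12).testBit i = true ↔ ∃ u, Lists st nb v u ∧
        (l v ^^^ l u).testBit i = true := by
  have h1' : 1 % 2 ^ W = 1 := Nat.mod_eq_of_lt L.one_lt
  have hlt := L.start_lt_of_le (v := v + 1) hv
  have hle := L.start_mono v hv
  refine Runs.init (50 * (st (v + 1) - st v) + 10)
    (R := fun s' => s'.arr = s.arr ∧ s'.reg 0 = s.reg 0 ∧ s'.reg 1 = s.reg 1 ∧ s'.reg 3 = v ∧
      s'.reg 6 = s.reg 6 ∧ s'.reg 11 = s.reg 11 ∧ s'.reg 12 = 0 ∧ s'.reg 4 = st v)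
    (by simp [Prog.LoopFree])
    (by simp [Prog.result, Expr.eval, State.setReg_reg, State.setReg_arr, h3, hst])
    (by simp [Prog.bound, Expr.cost]; omega) ?_
  rintro s₁ ⟨ha, h0, h1, h3, h6, h11, h12, h4⟩
  refine Runs.loop (fun s' => s'.arr = s.arr ∧ s'.reg 0 = s.reg 0 ∧ s'.reg 1 = s.reg 1 ∧
      s'.reg 3 = v ∧ s'.reg 6 = s.reg 6 ∧ s'.reg 11 = s.reg 11 ∧ st v ≤ s'.reg 4 ∧
      s'.reg 4 ≤ st (v + 1) ∧ ∀ i, (s'.reg 12).testBit i = true ↔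
        ∃ k, st v ≤ k ∧ k < s'.reg 4 ∧ (l v ^^^ l (nb k)).testBit i = true)
    (fun s' => 50 * (st (v + 1) - s'.reg 4))
    ⟨ha, h0, h1, h3, h6, h11, by omega, by omega, ?_⟩
    (by simp [Expr.cost, listEnd]; omega) ?_ ?_
  · intro i
    simp only [h12, h4, Nat.zero_testBit, Bool.false_eq_true, false_iff]
    rintro ⟨k, h1, h2, -⟩; omega
  · rintro s₂ ⟨ha, h0, h1, h3, h6, h11, h4, h4', h12⟩ he
    rw [eval_lt_ne_zero L.one_lt, eval_listEnd L (by omega) (by rw [ha, hst]), h3] at he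
    simp only [Expr.eval] at he
    have hsucc : (s₂.reg 4 + 1) % 2 ^ W = s₂.reg 4 + 1 := Nat.mod_eq_of_lt (by omega)
    have hn := L.entry_lt v hv _ h4 he
    refine ⟨directionBody.bound, Runs.of_loopFree (by simp [Prog.LoopFree, directionBody]) ?_⟩
    have hx : (l v ^^^ l (nb (s₂.reg 4))) < 2 ^ h := Nat.xor_lt_two_pow (hl v hv) (hl _ hn)
    have hxm : (l v ^^^ l (nb (s₂.reg 4))) % 2 ^ W = l v ^^^ l (nb (s₂.reg 4)) :=
      Nat.mod_eq_of_lt (lt_of_lt_of_le hx (Nat.pow_le_pow_right two_pos hh))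
    have e12 : (directionBody.result W s₂).reg 12 =
        (s₂.reg 12 ||| (l v ^^^ l (nb (s₂.reg 4)))) % 2 ^ W := by
      simp [directionBody, Prog.result, Expr.eval, Op.eval, State.setReg_reg, ha, h3, hlab v hv,
        hnb, hlab _ hn, hxm]
    have e4 : (directionBody.result W s₂).reg 4 = s₂.reg 4 + 1 := by
      simp [directionBody, Prog.result, Expr.eval, Op.eval, State.setReg_reg, h1', hsucc]
    refine ⟨⟨ha, ?_, ?_, ?_, ?_, ?_, by omega, by omega, ?_⟩, ?_⟩
    · simpa [directionBody, Prog.result, State.setReg_reg] using h0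
    · simpa [directionBody, Prog.result, State.setReg_reg] using h1
    · simpa [directionBody, Prog.result, State.setReg_reg] using h3
    · simpa [directionBody, Prog.result, State.setReg_reg] using h6
    · simpa [directionBody, Prog.result, State.setReg_reg] using h11
    · intro i
      rw [e12, e4, testBit_or_mod, h12]
      constructor
      · rintro ⟨-, ⟨k, hk, hk', hb⟩ | hb⟩
        · exact ⟨k, hk, by omega, hb⟩
        · exact ⟨s₂.reg 4, h4, by omega, hb⟩
      · rintro ⟨k, hk, hk', hb⟩
        have hnk := L.entry_lt v hv k hk (by omega)
        refine ⟨(lt_of_testBit (Nat.xor_lt_two_pow (hl v hv) (hl _ hnk)) hb).trans_le hh, ?_⟩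
        rcases Nat.lt_succ_iff_lt_or_eq.1 hk' with h | rfl
        · exact Or.inl ⟨k, hk, h, hb⟩
        · exact Or.inr hb
    · rw [e4]; simp [Expr.cost, listEnd, directionBody, Prog.bound]; omega
  · rintro s₂ ⟨ha, h0, h1, h3, h6, h11, h4, h4', h12⟩ he
    have hend : s₂.reg 4 = st (v + 1) := by
      by_contra hne
      refine (eval_lt_ne_zero L.one_lt _ _).2 ?_ he
      rw [eval_listEnd L (by omega) (by rw [ha, hst]), h3]
      simp only [Expr.eval]; omega
    refine ⟨ha, h0, h1, h3, h6, h11, fun i => ?_⟩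
    rw [h12, hend]
    constructor
    · rintro ⟨k, hk, hk', hb⟩; exact ⟨nb k, ⟨k, hk, hk', rfl⟩, hb⟩
    · rintro ⟨_, ⟨k, hk, hk', rfl⟩, hb⟩; exact ⟨k, hk, hk', hb⟩

theorem runs_missing (L : WordLists W n st nb) (hh : h ≤ W)
    (hl : ∀ w < n, l w < 2 ^ h) (h0 : s.reg 0 = n) (hst : s.arr 0 = st) (hnb : s.arr 1 = nb)
    (hlab : ∀ w < n, s.arr 2 w = l w) (h6 : ∀ i, (s.reg 6).testBit i = true ↔ i < h) :
    Runs W missing s (50 * st n + 200 * n + 50) fun s' =>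
      s'.arr = s.arr ∧ s'.reg 0 = n ∧ s'.reg 1 = s.reg 1 ∧
      ∀ i, (s'.reg 11).testBit i = true ↔ ∃ w < n, (l w).testBit i = true ∧
        ¬ ∃ u, Lists st nb w u ∧ (l w ^^^ l u).testBit i = true := by
  have h1' : 1 % 2 ^ W = 1 := Nat.mod_eq_of_lt L.one_lt
  refine Runs.init (50 * st n + 200 * n + 10)
    (R := fun s' => s'.arr = s.arr ∧ s'.reg 0 = n ∧ s'.reg 1 = s.reg 1 ∧ s'.reg 3 = 0 ∧
      s'.reg 6 = s.reg 6 ∧ s'.reg 11 = 0)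
    (by simp [Prog.LoopFree])
    (by simp [Prog.result, Expr.eval, State.setReg_reg, State.setReg_arr, h0])
    (by simp [Prog.bound, Expr.cost]; omega) ?_
  rintro s₁ ⟨ha, h0, h1, h3, h6', h11⟩
  -- The potential charges the list entries not yet scanned as well as the remaining vertices, so
  -- the inner loops are paid for in total and not by a maximum degree.
  refine Runs.loop (fun s' => s'.arr = s.arr ∧ s'.reg 0 = n ∧ s'.reg 1 = s.reg 1 ∧
      s'.reg 6 = s.reg 6 ∧ s'.reg 3 ≤ n ∧ ∀ i, (s'.reg 11).testBit i = true ↔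
        ∃ w < s'.reg 3, (l w).testBit i = true ∧
          ¬ ∃ u, Lists st nb w u ∧ (l w ^^^ l u).testBit i = true)
    (fun s' => 50 * (st n - st (s'.reg 3)) + 200 * (n - s'.reg 3))
    ⟨ha, h0, h1, h6', by omega, by simp [h3, h11]⟩
    (by simp [Expr.cost, h3, L.start_zero]) ?_ ?_
  · rintro s₂ ⟨ha, h0, h1, h6', h3, h11⟩ he
    rw [eval_lt_ne_zero L.one_lt] at he
    simp only [Expr.eval, h0] at he
    have hsucc : (s₂.reg 3 + 1) % 2 ^ W = s₂.reg 3 + 1 :=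
      Nat.mod_eq_of_lt (by have := L.size_lt; omega)
    have hle := L.start_mono _ he
    have hle' := L.start_le (v := s₂.reg 3 + 1) he le_rfl
    set v := s₂.reg 3 with hv
    refine ⟨_, Runs.seq (runs_directions L he hh hl (by rw [ha, hst]) (by rw [ha, hnb])
      (by rw [ha]; exact hlab) rfl) fun s₃ hs₃ => Runs.of_loopFree (by simp [Prog.LoopFree]) ?_⟩
    obtain ⟨ha₃, h0₃, h1₃, h3₃, h6₃, h11₃, h12⟩ := hs₃
    have hlv := hl v he
    have hlab₃ : s₃.arr 2 v = l v := by rw [ha₃, ha, hlab v he]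
    have hlW : l v < 2 ^ W := lt_of_lt_of_le hlv (Nat.pow_le_pow_right two_pos hh)
    refine ⟨⟨ha₃.trans ha, ?_, ?_, ?_, ?_, ?_⟩, ?_⟩
    · simp [Prog.result, State.setReg_reg, h0₃, h0]
    · simp [Prog.result, State.setReg_reg, h1₃, h1]
    · simp [Prog.result, State.setReg_reg, h6₃, h6']
    · simpa [Prog.result, Expr.eval, Op.eval, State.setReg_reg, h3₃, h1', hsucc] using he
    · intro i
      -- Register `6` is the mask of all `h` directions, so the XOR with register `12` is the
      -- complement of the directions present at `v`.
      have hbit : (((s₃.reg 6 ^^^ s₃.reg 12) % 2 ^ W &&& l v) % 2 ^ W).testBit i = true ↔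
          ((l v).testBit i = true ∧ ¬ ∃ u, Lists st nb v u ∧ (l v ^^^ l u).testBit i = true) := by
        rw [← h12, h6₃, h6']
        simp only [Nat.testBit_mod_two_pow, Nat.testBit_and, Nat.testBit_xor, Bool.and_eq_true,
          decide_eq_true_eq]
        constructor
        · rintro ⟨-, ⟨-, hx⟩, hb⟩
          refine ⟨hb, fun hc => ?_⟩
          rw [hc, (h6 i).2 (lt_of_testBit hlv hb)] at hx
          simp at hx
        · rintro ⟨hb, hc⟩
          have hi := lt_of_testBit hlv hb
          refine ⟨by omega, ⟨by omega, ?_⟩, hb⟩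
          rw [(h6 i).2 hi, Bool.eq_false_of_not_eq_true hc]; rfl
      simp only [Prog.result, Expr.eval, Op.eval, State.setReg_reg, h3₃, h1',
        hsucc, hlab₃, h11₃, if_true, if_false,
        show (11 : ℕ) ≠ 3 by simp, show (3 : ℕ) ≠ 11 by simp]
      rw [testBit_or_mod, hbit, h11]
      constructor
      · rintro ⟨-, ⟨w, hw, hb⟩ | hb⟩
        · exact ⟨w, by omega, hb⟩
        · exact ⟨v, by omega, hb⟩
      · rintro ⟨w, hw, hb⟩
        refine ⟨(lt_of_testBit (hl w (by omega)) hb.1).trans_le hh, ?_⟩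
        rcases Nat.lt_succ_iff_lt_or_eq.1 hw with h | rfl
        · exact Or.inl ⟨w, h, hb⟩
        · exact Or.inr hb
    · simp [Prog.result, Prog.bound, Expr.cost, Expr.eval, Op.eval, State.setReg_reg, h3₃, h1',
        hsucc]
      omega
  · rintro s₂ ⟨ha, h0, h1, h6', h3, h11⟩ he
    have hend : s₂.reg 3 = n := by
      by_contra hne
      refine (eval_lt_ne_zero L.one_lt _ _).2 ?_ he
      simp only [Expr.eval]; omega
    exact ⟨ha, h0, h1, by rw [← hend]; exact h11⟩

/-! ### The final labels -/

/-- Inverts the directions in register `11` in the label of the vertex in register `3`. -/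
def invertBody : Prog :=
  .seq (.store 2 (.reg 3) (.bin .xor (.read 2 (.reg 3)) (.reg 11)))
    (.assign 3 (.bin .add (.reg 3) (.lit 1)))

/-- Inverts the directions in register `11` in all labels. -/
def invert : Prog :=
  .seq (.assign 3 (.lit 0)) (.loop (.bin .lt (.reg 3) (.reg 0)) invertBody)

theorem runs_invert (hn : n + 1 < 2 ^ W) {B : ℕ} (hB : B < 2 ^ W)
    (hl : ∀ w < n, l w < 2 ^ W) (h0 : s.reg 0 = n) (h11 : s.reg 11 = B)
    (hlab : ∀ w < n, s.arr 2 w = l w) :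
    Runs W invert s (50 * n + 50) fun s' =>
      s'.reg 1 = s.reg 1 ∧ ∀ w < n, s'.arr 2 w = l w ^^^ B := by
  have hW : 1 < 2 ^ W := by omega
  have h1' : 1 % 2 ^ W = 1 := Nat.mod_eq_of_lt hW
  refine Runs.init (50 * n + 10)
    (R := fun s' => s'.arr = s.arr ∧ s'.reg 0 = n ∧ s'.reg 1 = s.reg 1 ∧ s'.reg 3 = 0 ∧
      s'.reg 11 = B)
    (by simp [Prog.LoopFree])
    (by simp [Prog.result, Expr.eval, State.setReg_reg, State.setReg_arr, h0, h11])
    (by simp [Prog.bound, Expr.cost]; omega) ?_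
  rintro s₁ ⟨ha, h0, h1, h3, h11⟩
  refine Runs.loop (fun s' => s'.reg 0 = n ∧ s'.reg 1 = s.reg 1 ∧ s'.reg 11 = B ∧
      s'.reg 3 ≤ n ∧ (∀ w < s'.reg 3, s'.arr 2 w = l w ^^^ B) ∧
      ∀ w < n, s'.reg 3 ≤ w → s'.arr 2 w = l w)
    (fun s' => 50 * (n - s'.reg 3))
    ⟨h0, h1, h11, by omega, by simp [h3], fun w hw _ => by rw [ha, hlab w hw]⟩
    (by simp [Expr.cost, h3]) ?_ ?_
  · rintro s₂ ⟨h0, h1, h11, h3, hdone, hrest⟩ he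
    rw [eval_lt_ne_zero hW] at he
    simp only [Expr.eval, h0] at he
    have hsucc : (s₂.reg 3 + 1) % 2 ^ W = s₂.reg 3 + 1 := Nat.mod_eq_of_lt (by omega)
    have hx : (l (s₂.reg 3) ^^^ B) % 2 ^ W = l (s₂.reg 3) ^^^ B :=
      Nat.mod_eq_of_lt (Nat.xor_lt_two_pow (hl _ he) hB)
    have e3 : (invertBody.result W s₂).reg 3 = s₂.reg 3 + 1 := by
      simp [invertBody, Prog.result, Expr.eval, Op.eval, State.setReg_reg, State.setArr_reg, h1',
        hsucc]
    have e2 : (invertBody.result W s₂).arr 2 =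
        Function.update (s₂.arr 2) (s₂.reg 3) (l (s₂.reg 3) ^^^ B) := by
      simp [invertBody, Prog.result, Expr.eval, Op.eval, State.setReg_arr, State.setArr_arr,
        hrest _ he le_rfl, h11, hx]
    refine ⟨_, Runs.of_loopFree (by simp [Prog.LoopFree, invertBody]) ⟨⟨?_, ?_, ?_, ?_, ?_, ?_⟩,
      ?_⟩⟩
    · simpa [invertBody, Prog.result, State.setReg_reg, State.setArr_reg] using h0
    · simpa [invertBody, Prog.result, State.setReg_reg, State.setArr_reg] using h1
    · simpa [invertBody, Prog.result, State.setReg_reg, State.setArr_reg] using h11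
    · omega
    · intro w hw
      rw [e3] at hw
      rw [e2]
      rcases Nat.lt_succ_iff_lt_or_eq.1 hw with h | rfl
      · rw [Function.update_of_ne (by omega)]; exact hdone w h
      · rw [Function.update_self]
    · intro w hw hw'
      rw [e3] at hw'
      rw [e2, Function.update_of_ne (by omega)]
      exact hrest w hw (by omega)
    · rw [e3]; simp [Expr.cost, invertBody, Prog.bound]; omega
  · rintro s₂ ⟨h0, h1, h11, h3, hdone, hrest⟩ he
    have hend : s₂.reg 3 = n := by
      by_contra hne
      refine (eval_lt_ne_zero hW _ _).2 ?_ he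
      simp only [Expr.eval]; omega
    exact ⟨h1, by rw [← hend]; exact hdone⟩

end DaisyCube

namespace DaisyCube

/-! ### Breadth-first search -/

section Invariant

variable {n h : ℕ} {st nb : ℕ → ℕ} {r : ℕ} {l d : ℕ → ℕ} {queue dist lab : ℕ → ℕ}
  {head tail j : ℕ}

/-- The entry `w` in the list of `u` has been taken into account. -/
def Relaxed (l d dist lab : ℕ → ℕ) (u w : ℕ) : Prop :=
  dist w ≠ 0 ∧ (d w = d u + 1 → ∀ i, (l u).testBit i = true → (lab w).testBit i = true)

/-- The invariant of a breadth-first search from `r` that propagates labels: the vertices before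
position `head` of the queue are finished, and the list of the next one is finished up to the
cell `j`. -/
structure SearchInv (n h : ℕ) (st nb : ℕ → ℕ) (r : ℕ) (l d : ℕ → ℕ) (queue dist lab : ℕ → ℕ)
    (head tail j : ℕ) : Prop where
  head_le : head ≤ tail
  tail_pos : 0 < tail
  queue_zero : queue 0 = r
  queue_lt : ∀ i < tail, queue i < n
  queue_inj : ∀ i < tail, ∀ k < tail, queue i = queue k → i = k
  dist_queue : ∀ i < tail, dist (queue i) = d (queue i) + 1
  mem_queue : ∀ w, dist w ≠ 0 → ∃ i < tail, queue i = w
  sorted : ∀ i k, i ≤ k → k < tail → d (queue i) ≤ d (queue k)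
  near : head < tail → ∀ k < tail, d (queue k) ≤ d (queue head) + 1
  lab_sub : ∀ w < n, ∀ i, (lab w).testBit i = true → (l w).testBit i = true
  lab_init : ∀ i < h, (lab (nb (st r + i))).testBit i = true
  finished : ∀ i < head, ∀ w, Lists st nb (queue i) w → Relaxed l d dist lab (queue i) w
  current : ∀ k, st (queue head) ≤ k → k < j → Relaxed l d dist lab (queue head) (nb k)

/-- Queue entries are distinct vertices; the bound keeps the queue positions within a word. -/
theorem SearchInv.tail_le (I : SearchInv n h st nb r l d queue dist lab head tail j) :
    tail ≤ n := by
  have := Fintype.card_le_of_injective (fun i : Fin tail => (⟨queue i, I.queue_lt i i.2⟩ : Fin n))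
    (fun a b hab => Fin.ext (I.queue_inj a a.2 b b.2 (congrArg Fin.val hab)))
  simpa using this

/-- Everything strictly closer to `r` than the head is finished. By induction on the distance, a
parent of `x` is finished, hence `x` has been queued, and sortedness places it before the head. -/
theorem SearchInv.exists_lt_head (I : SearchInv n h st nb r l d queue dist lab head tail j)
    (P : Propagates n h st nb r l d) (e : ℕ) :
    ∀ x < n, d x = e → d x < d (queue head) → ∃ i < head, queue i = x := by
  have hidx : ∀ i < tail, d (queue i) < d (queue head) → i < head := by
    intro i hi hlt
    by_contra hge
    have := I.sorted head i (by omega) hi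
    omega
  induction e with
  | zero =>
    intro x hx hd hlt
    have hxr := P.eq_root x hx hd
    subst hxr
    exact ⟨0, hidx 0 I.tail_pos (by rw [I.queue_zero]; exact hlt), I.queue_zero⟩
  | succ e ih =>
    intro x hx hd hlt
    obtain ⟨u, hu, hux, hdu⟩ := P.parent x hx (by omega)
    obtain ⟨i, hi, rfl⟩ := ih u hu (by omega) (by omega)
    obtain ⟨k, hk, rfl⟩ := I.mem_queue x (I.finished i hi x hux).1
    exact ⟨k, hidx k hk hlt, rfl⟩

/-- A parent of `x` is strictly closer than the head, hence finished. Consequently an undiscovered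
neighbour of the head lies exactly one level farther out. -/
theorem SearchInv.dist_ne_zero_of_le (I : SearchInv n h st nb r l d queue dist lab head tail j)
    (P : Propagates n h st nb r l d) {x : ℕ} (hx : x < n)
    (hd : d x ≤ d (queue head)) : dist x ≠ 0 := by
  by_cases h0 : d x = 0
  · have := I.dist_queue 0 I.tail_pos
    rw [I.queue_zero, ← P.eq_root x hx h0] at this
    omega
  · obtain ⟨u, hu, hux, hdu⟩ := P.parent x hx h0
    obtain ⟨i, hi, rfl⟩ := I.exists_lt_head P _ u hu rfl (by omega)
    exact (I.finished i hi x hux).1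

theorem SearchInv.lab_eq_of_finished (I : SearchInv n h st nb r l d queue dist lab head tail j)
    (P : Propagates n h st nb r l d) {x : ℕ} (hx : x < n)
    (hfin : ∀ u < n, Lists st nb u x → d x = d u + 1 → ∃ i < head, queue i = u) :
    lab x = l x := by
  apply Nat.eq_of_testBit_eq
  intro i
  rw [Bool.eq_iff_iff]
  refine ⟨I.lab_sub x hx i, fun hi => ?_⟩
  rcases P.bit_origin x hx i hi with ⟨hih, rfl⟩ | ⟨u, hu, hux, hdu, hb⟩
  · exact I.lab_init i hih
  · obtain ⟨k, hk, rfl⟩ := hfin u hu hux hdu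
    exact (I.finished k hk x hux).2 hdu i hb

/-- All predecessors of the head are finished, so the label it passes on is already final. -/
theorem SearchInv.lab_head (I : SearchInv n h st nb r l d queue dist lab head tail j)
    (P : Propagates n h st nb r l d) (hht : head < tail) :
    lab (queue head) = l (queue head) :=
  I.lab_eq_of_finished P (I.queue_lt head hht) fun u hu _ hdu =>
    I.exists_lt_head P _ u hu rfl (by omega)

/-- When the queue is exhausted, all labels are final. -/
theorem SearchInv.lab_eq (I : SearchInv n h st nb r l d queue dist lab head tail j)
    (P : Propagates n h st nb r l d) (hht : tail ≤ head) : ∀ x < n, lab x = l x := by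
  have hall : ∀ e, ∀ x < n, d x = e → ∃ i < head, queue i = x := by
    intro e
    induction e with
    | zero =>
      intro x hx hd
      exact ⟨0, I.tail_pos.trans_le hht, by rw [I.queue_zero, P.eq_root x hx hd]⟩
    | succ e ih =>
      intro x hx hd
      obtain ⟨u, hu, hux, hdu⟩ := P.parent x hx (by omega)
      obtain ⟨i, hi, rfl⟩ := ih u hu (by omega)
      obtain ⟨k, hk, rfl⟩ := I.mem_queue x (I.finished i hi x hux).1
      exact ⟨k, by omega, rfl⟩
  intro x hx
  exact I.lab_eq_of_finished P hx fun u hu _ _ => hall _ u hu rfl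

/-- The value `0` for `j` makes `current` vacuous: it stands for a head whose list has not been
opened, and which may not exist. -/
theorem SearchInv.next (I : SearchInv n h st nb r l d queue dist lab head tail j)
    (hht : head < tail) (hj : st (queue head + 1) ≤ j) :
    SearchInv n h st nb r l d queue dist lab (head + 1) tail 0 := by
  refine { I with head_le := hht, near := ?_, finished := ?_, current := ?_ }
  · intro hlt k hk
    have h1 := I.near hht k hk
    have h2 := I.sorted head (head + 1) (by omega) hlt
    omega
  · intro i hi w hw
    rcases Nat.lt_succ_iff_lt_or_eq.1 hi with hi | rfl
    · exact I.finished i hi w hw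
    · obtain ⟨k, hk, hk', rfl⟩ := hw
      exact I.current k hk (by omega)
  · intro k _ hk; omega

theorem SearchInv.start (I : SearchInv n h st nb r l d queue dist lab head tail 0) :
    SearchInv n h st nb r l d queue dist lab head tail (st (queue head)) :=
  { I with current := fun k hk hk' => by omega }

/-- Taking the next list entry into account preserves the invariant. -/
theorem SearchInv.step (I : SearchInv n h st nb r l d queue dist lab head tail j)
    (P : Propagates n h st nb r l d) {W : ℕ} (hh : h ≤ W) (hht : head < tail)
    (hj : st (queue head) ≤ j) (hj' : j < st (queue head + 1)) (hw : nb j < n) :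
    SearchInv n h st nb r l d
      (if dist (nb j) = 0 then Function.update queue tail (nb j) else queue)
      (if dist (nb j) = 0 then Function.update dist (nb j) (dist (queue head) + 1) else dist)
      (if dist (nb j) = 0 ∨ dist (nb j) = dist (queue head) + 1 then
        Function.update lab (nb j) ((lab (nb j) ||| lab (queue head)) % 2 ^ W) else lab)
      head (if dist (nb j) = 0 then tail + 1 else tail) (j + 1) := by
  set w := nb j with hwdef
  set u := queue head with hu
  have hun : u < n := I.queue_lt head hht
  have huw : Lists st nb u w := ⟨j, hj, hj', rfl⟩
  have hdu : dist u = d u + 1 := I.dist_queue head hht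
  have hdw : dist w = 0 ∨ dist w = d w + 1 := by
    by_cases h0 : dist w = 0
    · exact Or.inl h0
    · obtain ⟨i, hi, hiw⟩ := I.mem_queue w h0
      exact Or.inr (by rw [← hiw]; exact I.dist_queue i hi)
  have hnew : dist w = 0 → d w = d u + 1 := by
    intro h0
    have h1 := P.dist_step u hun w huw
    have h2 : ¬ d w ≤ d u := fun hle => I.dist_ne_zero_of_le P hw hle h0
    omega
  -- The stored distances thus decide correctly whether `u` precedes `w`, including when `w` is only
  -- now discovered.
  have hcond : (dist w = 0 ∨ dist w = dist u + 1) ↔ d w = d u + 1 := by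
    constructor
    · rintro (h0 | h1)
      · exact hnew h0
      · omega
    · intro h1
      rcases hdw with h0 | h0
      · exact Or.inl h0
      · exact Or.inr (by omega)
  have hlabu : lab u = l u := I.lab_head P hht
  set lab' := (if dist w = 0 ∨ dist w = dist u + 1 then
        Function.update lab w ((lab w ||| lab u) % 2 ^ W) else lab) with hlab'
  have hbits : ∀ x i, (lab' x).testBit i = true ↔ ((lab x).testBit i = true ∨
      (x = w ∧ d w = d u + 1 ∧ (l u).testBit i = true)) := by
    intro x i
    rw [hlab']
    simp only [hcond]
    by_cases hc : d w = d u + 1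
    · rw [if_pos hc]
      by_cases hx : x = w
      · subst hx
        rw [Function.update_self, testBit_or_mod, hlabu]
        constructor
        · rintro ⟨-, h1 | h1⟩
          · exact Or.inl h1
          · exact Or.inr ⟨rfl, hc, h1⟩
        · intro h1
          have hb : (lab w).testBit i = true ∨ (l u).testBit i = true :=
            h1.imp id fun h2 => h2.2.2
          refine ⟨lt_of_lt_of_le ?_ hh, hb⟩
          rcases hb with hb | hb
          · exact lt_of_testBit (P.label_lt w hw) (I.lab_sub w hw i hb)
          · exact lt_of_testBit (P.label_lt u hun) hb
      · rw [Function.update_of_ne hx]; simp [hx]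
    · rw [if_neg hc]; simp [hc]
  have hrelax : ∀ dist' : ℕ → ℕ, (∀ x, dist x ≠ 0 → dist' x ≠ 0) → ∀ a b,
      Relaxed l d dist lab a b → Relaxed l d dist' lab' a b := fun dist' hd' a b hab =>
    ⟨hd' b hab.1, fun h1 i h2 => (hbits b i).2 (Or.inl (hab.2 h1 i h2))⟩
  have hrelax_uw : ∀ dist' : ℕ → ℕ, dist' w ≠ 0 → Relaxed l d dist' lab' u w :=
    fun dist' hd' => ⟨hd', fun h1 i h2 => (hbits w i).2 (Or.inr ⟨rfl, h1, h2⟩)⟩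
  have hsub : ∀ x < n, ∀ i, (lab' x).testBit i = true → (l x).testBit i = true := by
    intro x hx i hi
    rcases (hbits x i).1 hi with h1 | ⟨rfl, h1, h2⟩
    · exact I.lab_sub x hx i h1
    · exact P.label_mono u hun w huw h1 i h2
  have hinit : ∀ i < h, (lab' (nb (st r + i))).testBit i = true := fun i hi =>
    (hbits _ i).2 (Or.inl (I.lab_init i hi))
  clear_value lab'
  by_cases h0 : dist w = 0
  · rw [if_pos h0, if_pos h0, if_pos h0]
    have hwd := hnew h0
    have hq : ∀ i < tail, Function.update queue tail w i = queue i := fun i hi =>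
      Function.update_of_ne (by omega) _ _
    have hqt : Function.update queue tail w tail = w := Function.update_self _ _ _
    have hfresh : ∀ i < tail, queue i ≠ w := by
      intro i hi hiw
      have := I.dist_queue i hi
      rw [hiw] at this; omega
    have hd' : ∀ x, dist x ≠ 0 → Function.update dist w (dist u + 1) x ≠ 0 := by
      intro x hx
      by_cases hxw : x = w
      · subst hxw; exact absurd h0 hx
      · rwa [Function.update_of_ne hxw]
    have hqh : Function.update queue tail w head = u := hq head hht
    refine ⟨by have := I.head_le; omega, by omega, ?_, ?_, ?_, ?_, ?_, ?_, ?_, hsub, hinit, ?_, ?_⟩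
    · rw [hq 0 I.tail_pos]; exact I.queue_zero
    · intro i hi
      rcases Nat.lt_succ_iff_lt_or_eq.1 hi with hi | rfl
      · rw [hq i hi]; exact I.queue_lt i hi
      · rw [hqt]; exact hw
    · intro i hi k hk hik
      rcases Nat.lt_succ_iff_lt_or_eq.1 hi with hi | rfl <;>
        rcases Nat.lt_succ_iff_lt_or_eq.1 hk with hk | hk
      · rw [hq i hi, hq k hk] at hik; exact I.queue_inj i hi k hk hik
      · subst hk; rw [hq i hi, hqt] at hik; exact absurd hik (hfresh i hi)
      · rw [hq k hk, hqt] at hik; exact absurd hik.symm (hfresh k hk)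
      · exact hk.symm
    · intro i hi
      rcases Nat.lt_succ_iff_lt_or_eq.1 hi with hi | rfl
      · rw [hq i hi, Function.update_of_ne (hfresh i hi)]; exact I.dist_queue i hi
      · rw [hqt, Function.update_self]; omega
    · intro x hx
      by_cases hxw : x = w
      · exact ⟨tail, by omega, by rw [hqt, hxw]⟩
      · rw [Function.update_of_ne hxw] at hx
        obtain ⟨i, hi, hix⟩ := I.mem_queue x hx
        exact ⟨i, by omega, by rw [hq i hi, hix]⟩
    · intro i k hik hk
      rcases Nat.lt_succ_iff_lt_or_eq.1 hk with hk | rfl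
      · rw [hq i (by omega), hq k hk]; exact I.sorted i k hik hk
      · rw [hqt]
        rcases Nat.lt_or_eq_of_le hik with hi | rfl
        -- The appended vertex is one level beyond the head, and `near` says that no queued vertex
        -- is farther.
        · rw [hq i hi, hwd]; exact I.near hht i hi
        · rw [hqt]
    · intro _ k hk
      rw [hqh]
      rcases Nat.lt_succ_iff_lt_or_eq.1 hk with hk | rfl
      · rw [hq k hk]; exact I.near hht k hk
      · rw [hqt]; omega
    · intro i hi x hx
      rw [hq i (by omega)] at hx ⊢
      exact hrelax _ hd' _ _ (I.finished i hi x hx)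
    · intro k hk hk'
      rw [hqh] at hk ⊢
      rcases Nat.lt_succ_iff_lt_or_eq.1 hk' with hk' | rfl
      · exact hrelax _ hd' _ _ (I.current k hk hk')
      · exact hrelax_uw _ (by rw [Function.update_self]; omega)
  · rw [if_neg h0, if_neg h0, if_neg h0]
    refine { I with lab_sub := hsub, lab_init := hinit, finished := ?_, current := ?_ }
    · exact fun i hi x hx => hrelax _ (fun _ h => h) _ _ (I.finished i hi x hx)
    · intro k hk hk'
      rcases Nat.lt_succ_iff_lt_or_eq.1 hk' with hk' | rfl
      · exact hrelax _ (fun _ h => h) _ _ (I.current k hk hk')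
      · exact hrelax_uw _ h0

end Invariant

/-- Enqueues the vertex in register `10` as a child of the vertex in register `9`. -/
def enqueue : Prog :=
  .seq (.store 4 (.reg 10) (.bin .add (.read 4 (.reg 9)) (.lit 1)))
    (.seq (.store 3 (.reg 8) (.reg 10)) (.assign 8 (.bin .add (.reg 8) (.lit 1))))

/-- Takes the list entry in cell `reg 4` of the vertex in register `9` into account. -/
def relaxBody : Prog :=
  .seq (.assign 10 (.read 1 (.reg 4)))
    (.seq (.cond (.read 4 (.reg 10)) .skip enqueue)
      (.seq (.cond (.bin .eq (.read 4 (.reg 10)) (.bin .add (.read 4 (.reg 9)) (.lit 1)))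
        (.store 2 (.reg 10) (.bin .or (.read 2 (.reg 10)) (.read 2 (.reg 9)))) .skip)
        (.assign 4 (.bin .add (.reg 4) (.lit 1)))))

/-- Processes the vertex at the head of the queue. -/
def searchBody : Prog :=
  .seq (.seq (.assign 9 (.read 3 (.reg 7))) (.assign 4 (.read 0 (.reg 9))))
    (.seq (.loop (.bin .lt (.reg 4) (listEnd 9)) relaxBody)
      (.assign 7 (.bin .add (.reg 7) (.lit 1))))

/-- Breadth-first search from the vertex in register `2`, with the queue in array `3`, distances
plus one in array `4`, and labels in array `2`. -/
def search : Prog :=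
  .seq (.seq (.store 3 (.lit 0) (.reg 2)) (.seq (.store 4 (.reg 2) (.lit 1))
    (.seq (.assign 7 (.lit 0)) (.assign 8 (.lit 1)))))
    (.loop (.bin .lt (.reg 7) (.reg 8)) searchBody)

variable {W : ℕ} {s : State} {n h r : ℕ} {st nb l d : ℕ → ℕ}

theorem runs_relaxBody (hW : 1 < 2 ^ W) (h4 : s.reg 4 + 1 < 2 ^ W) (h8 : s.reg 8 + 1 < 2 ^ W)
    (hd : s.arr 4 (s.reg 9) + 1 < 2 ^ W) (hd0 : s.arr 4 (s.reg 9) ≠ 0) :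
    Runs W relaxBody s 80 fun s' =>
      s'.arr 0 = s.arr 0 ∧ s'.arr 1 = s.arr 1 ∧ s'.reg 0 = s.reg 0 ∧ s'.reg 1 = s.reg 1 ∧
      s'.reg 6 = s.reg 6 ∧ s'.reg 7 = s.reg 7 ∧ s'.reg 9 = s.reg 9 ∧ s'.reg 4 = s.reg 4 + 1 ∧
      s'.reg 8 = (if s.arr 4 (s.arr 1 (s.reg 4)) = 0 then s.reg 8 + 1 else s.reg 8) ∧
      s'.arr 3 = (if s.arr 4 (s.arr 1 (s.reg 4)) = 0 then
        Function.update (s.arr 3) (s.reg 8) (s.arr 1 (s.reg 4)) else s.arr 3) ∧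
      s'.arr 4 = (if s.arr 4 (s.arr 1 (s.reg 4)) = 0 then
        Function.update (s.arr 4) (s.arr 1 (s.reg 4)) (s.arr 4 (s.reg 9) + 1) else s.arr 4) ∧
      s'.arr 2 = (if s.arr 4 (s.arr 1 (s.reg 4)) = 0 ∨
          s.arr 4 (s.arr 1 (s.reg 4)) = s.arr 4 (s.reg 9) + 1 then
        Function.update (s.arr 2) (s.arr 1 (s.reg 4))
          ((s.arr 2 (s.arr 1 (s.reg 4)) ||| s.arr 2 (s.reg 9)) % 2 ^ W) else s.arr 2) := by
  have h1 : 1 % 2 ^ W = 1 := Nat.mod_eq_of_lt hW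
  have e4 : (s.reg 4 + 1) % 2 ^ W = s.reg 4 + 1 := Nat.mod_eq_of_lt h4
  have e8 : (s.reg 8 + 1) % 2 ^ W = s.reg 8 + 1 := Nat.mod_eq_of_lt h8
  have ed : (s.arr 4 (s.reg 9) + 1) % 2 ^ W = s.arr 4 (s.reg 9) + 1 := Nat.mod_eq_of_lt hd
  refine (Runs.of_loopFree (by simp [Prog.LoopFree, relaxBody, enqueue]) ?_).mono
    (by simp [relaxBody, enqueue, Prog.bound, Expr.cost]) fun _ h => h
  by_cases h0 : s.arr 4 (s.arr 1 (s.reg 4)) = 0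
  -- A discovered vertex differs from a fresh one, so enqueuing leaves the distance of register `9`
  -- intact and the equality test that follows succeeds.
  · have hne : s.reg 9 ≠ s.arr 1 (s.reg 4) := fun he => hd0 (he ▸ h0)
    simp [relaxBody, enqueue, Prog.result, Expr.eval, Op.eval, h0, h1, e4, e8, ed, hne,
      State.setReg_reg, State.setReg_arr, State.setArr_arr, State.setArr_reg]
  · by_cases hc : s.arr 4 (s.arr 1 (s.reg 4)) = s.arr 4 (s.reg 9) + 1 <;>
    simp [relaxBody, Prog.result, Expr.eval, Op.eval, h0, hc, h1, e4, ed,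
      State.setReg_reg, State.setReg_arr, State.setArr_arr, State.setArr_reg]

theorem runs_searchBody (L : WordLists W n st nb) (P : Propagates n h st nb r l d) (hh : h ≤ W)
    (hhW : h + 2 < 2 ^ W) (hst : s.arr 0 = st) (hnb : s.arr 1 = nb)
    (I : SearchInv n h st nb r l d (s.arr 3) (s.arr 4) (s.arr 2) (s.reg 7) (s.reg 8) 0)
    (hlt : s.reg 7 < s.reg 8) :
    Runs W searchBody s (100 * (st (s.arr 3 (s.reg 7) + 1) - st (s.arr 3 (s.reg 7))) + 50) fun s' =>
      s'.arr 0 = st ∧ s'.arr 1 = nb ∧ s'.reg 0 = s.reg 0 ∧ s'.reg 1 = s.reg 1 ∧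
      s'.reg 6 = s.reg 6 ∧ s'.reg 7 = s.reg 7 + 1 ∧
      SearchInv n h st nb r l d (s'.arr 3) (s'.arr 4) (s'.arr 2) (s'.reg 7) (s'.reg 8) 0 ∧
      ∀ i < s.reg 8, s'.arr 3 i = s.arr 3 i := by
  have h1' : 1 % 2 ^ W = 1 := Nat.mod_eq_of_lt L.one_lt
  set u := s.arr 3 (s.reg 7) with hu
  have hun : u < n := I.queue_lt _ hlt
  have hend := L.start_lt_of_le (v := u + 1) hun
  have hmono := L.start_mono u hun
  refine Runs.init (100 * (st (u + 1) - st u) + 40)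
    (R := fun s' => s'.arr = s.arr ∧ s'.reg 0 = s.reg 0 ∧ s'.reg 1 = s.reg 1 ∧
      s'.reg 6 = s.reg 6 ∧ s'.reg 7 = s.reg 7 ∧ s'.reg 8 = s.reg 8 ∧ s'.reg 9 = u ∧
      s'.reg 4 = st u)
    (by simp [Prog.LoopFree])
    (by simp [Prog.result, Expr.eval, State.setReg_reg, State.setReg_arr, hst, hu])
    (by simp [Prog.bound, Expr.cost]; omega) ?_
  rintro s₁ ⟨ha, h0, h1, h6, h7, h8, h9, h4⟩
  refine (Runs.seq (T := 100 * (st (u + 1) - st u) + 10)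
    (R := fun s' => s'.arr 0 = st ∧ s'.arr 1 = nb ∧ s'.reg 0 = s.reg 0 ∧ s'.reg 1 = s.reg 1 ∧
      s'.reg 6 = s.reg 6 ∧ s'.reg 7 = s.reg 7 ∧ s.reg 8 ≤ s'.reg 8 ∧
      SearchInv n h st nb r l d (s'.arr 3) (s'.arr 4) (s'.arr 2) (s.reg 7) (s'.reg 8)
        (st (u + 1)) ∧
      ∀ i < s.reg 8, s'.arr 3 i = s.arr 3 i) ?_ (T' := 5) ?_).mono (by omega) fun _ h => h
  · refine Runs.loop (fun s' => s'.arr 0 = st ∧ s'.arr 1 = nb ∧ s'.reg 0 = s.reg 0 ∧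
        s'.reg 1 = s.reg 1 ∧ s'.reg 6 = s.reg 6 ∧ s'.reg 7 = s.reg 7 ∧ s'.reg 9 = u ∧
        s.reg 8 ≤ s'.reg 8 ∧ st u ≤ s'.reg 4 ∧ s'.reg 4 ≤ st (u + 1) ∧
        SearchInv n h st nb r l d (s'.arr 3) (s'.arr 4) (s'.arr 2) (s.reg 7) (s'.reg 8)
          (s'.reg 4) ∧
        ∀ i < s.reg 8, s'.arr 3 i = s.arr 3 i)
      (fun s' => 100 * (st (u + 1) - s'.reg 4))
      ⟨by rw [ha, hst], by rw [ha, hnb], h0, h1, h6, h7, h9, by omega, by omega, by omega, ?_,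
        fun i _ => by rw [ha]⟩
      (by simp [Expr.cost, listEnd]; omega) ?_ ?_
    · rw [ha, h8, h4]; exact I.start
    · rintro s₂ ⟨ha0, ha1, h0, h1, h6, h7, h9, h8, h4, h4', I₂, hq⟩ he
      rw [eval_lt_ne_zero L.one_lt, eval_listEnd L (by omega) ha0, h9] at he
      simp only [Expr.eval] at he
      have hq7 : s₂.arr 3 (s.reg 7) = u := hq _ hlt
      have hlt₂ : s.reg 7 < s₂.reg 8 := by omega
      have hw := L.entry_lt u hun _ h4 he
      have hdu : s₂.arr 4 u = d u + 1 := by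
        have := I₂.dist_queue _ hlt₂
        rwa [hq7] at this
      have hdle := P.dist_le u hun
      have htl := I₂.tail_le
      have hsz := L.size_lt
      refine ⟨80, (runs_relaxBody L.one_lt (by omega) (by omega) (by rw [h9]; omega)
        (by rw [h9]; omega)).mono le_rfl ?_⟩
      rintro s₃ ⟨a0, a1, r0, r1, r6, r7, r9, r4, r8, a3, a4, a2⟩
      have I₃ := I₂.step P hh hlt₂ (by rw [hq7]; exact h4) (by rw [hq7]; exact he) hw
      rw [hq7] at I₃
      rw [h9, ha1] at a4 a2
      rw [ha1] at r8 a3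
      rw [← a3, ← a4, ← a2, ← r8, ← r4] at I₃
      refine ⟨⟨a0.trans ha0, a1.trans ha1, r0.trans h0, r1.trans h1, r6.trans h6, r7.trans h7,
        r9.trans h9, ?_, by omega, by omega, I₃, ?_⟩, ?_⟩
      · rw [r8]; split_ifs <;> omega
      · intro i hi
        rw [a3, ← hq i hi]
        split_ifs
        · exact Function.update_of_ne (by omega) _ _
        · rfl
      · simp only [Expr.cost, listEnd]; omega
    · rintro s₂ ⟨ha0, ha1, h0, h1, h6, h7, h9, h8, h4, h4', I₂, hq⟩ he
      have hend : s₂.reg 4 = st (u + 1) := by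
        by_contra hne
        refine (eval_lt_ne_zero L.one_lt _ _).2 ?_ he
        rw [eval_listEnd L (by omega) ha0, h9]
        simp only [Expr.eval]; omega
      rw [hend] at I₂
      exact ⟨ha0, ha1, h0, h1, h6, h7, h8, I₂, hq⟩
  · rintro s₂ ⟨ha0, ha1, h0, h1, h6, h7, h8, I₂, hq⟩
    have htl := I₂.tail_le
    have hsz := L.size_lt
    have e7 : (s.reg 7 + 1) % 2 ^ W = s.reg 7 + 1 := Nat.mod_eq_of_lt (by omega)
    refine (Runs.of_loopFree (by simp [Prog.LoopFree]) ?_).mono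
      (by simp [Prog.bound, Expr.cost]) fun _ h => h
    have I₃ := I₂.next (by omega) (by rw [hq _ hlt])
    simpa [Prog.result, Expr.eval, Op.eval, State.setReg_reg, State.setReg_arr, ha0, ha1, h0, h1,
      h6, h7, h1', e7] using ⟨I₃, hq⟩

/-- A sum over the distinct entries of a queue is at most the sum over all vertices. -/
theorem sum_queue_le {q : ℕ → ℕ} {k n : ℕ} (hq : ∀ i < k, q i < n)
    (hinj : ∀ i < k, ∀ j < k, q i = q j → i = j) (f : ℕ → ℕ) :
    ∑ i ∈ Finset.range k, f (q i) ≤ ∑ v ∈ Finset.range n, f v := by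
  rw [← Finset.sum_image (f := f) (s := Finset.range k) (g := q)]
  · apply Finset.sum_le_sum_of_subset
    intro v hv
    obtain ⟨i, hi, rfl⟩ := Finset.mem_image.1 hv
    exact Finset.mem_range.2 (hq i (Finset.mem_range.1 hi))
  · intro i hi j hj hij
    exact hinj i (by simpa using hi) j (by simpa using hj) hij

theorem AdjLists.sum_degree (L : AdjLists n st nb) (a b k : ℕ) (hk : k ≤ n) :
    ∑ v ∈ Finset.range k, (a * (st (v + 1) - st v) + b) = a * st k + b * k := by
  induction k with
  | zero => simp [L.start_zero]
  | succ k ih =>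
    have := L.start_mono k hk
    obtain ⟨c, hc⟩ := Nat.exists_eq_add_of_le this
    rw [Finset.sum_range_succ, ih (by omega), hc, Nat.add_sub_cancel_left]
    ring

theorem runs_search (L : WordLists W n st nb) (P : Propagates n h st nb r l d) (hh : h ≤ W)
    (hhW : h + 2 < 2 ^ W) (hst : s.arr 0 = st) (hnb : s.arr 1 = nb) (h0 : s.reg 0 = n)
    (h2 : s.reg 2 = r)
    (hdist : ∀ w, s.arr 4 w = 0)
    (hlab : ∀ w i, (s.arr 2 w).testBit i = true ↔ i < h ∧ nb (st r + i) = w) :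
    Runs W search s (100 * st n + 100 * n + 50) fun s' =>
      s'.arr 0 = st ∧ s'.arr 1 = nb ∧ s'.reg 0 = n ∧ s'.reg 1 = s.reg 1 ∧
      s'.reg 6 = s.reg 6 ∧ ∀ w < n, s'.arr 2 w = l w := by
  have h1' : 1 % 2 ^ W = 1 := Nat.mod_eq_of_lt L.one_lt
  let f : ℕ → ℕ := fun v => 100 * (st (v + 1) - st v) + 100
  have htotal : ∑ v ∈ Finset.range n, f v = 100 * st n + 100 * n :=
    L.sum_degree 100 100 n le_rfl
  refine Runs.init (100 * st n + 100 * n + 10)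
    (R := fun s' => s'.arr 0 = st ∧ s'.arr 1 = nb ∧ s'.reg 0 = n ∧ s'.reg 1 = s.reg 1 ∧
      s'.reg 6 = s.reg 6 ∧ s'.reg 7 = 0 ∧ s'.reg 8 = 1 ∧ s'.arr 2 = s.arr 2 ∧
      s'.arr 3 0 = r ∧ s'.arr 4 = Function.update (s.arr 4) r 1)
    (by simp [Prog.LoopFree])
    (by simp [Prog.result, Expr.eval, State.setReg_reg, State.setReg_arr, State.setArr_arr,
      State.setArr_reg, hst, hnb, h0, h2, h1'])
    (by simp [Prog.bound, Expr.cost]; omega) ?_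
  rintro s₁ ⟨a0, a1, r0, r1, r6, r7, r8, a2, a3, a4⟩
  have Istart : SearchInv n h st nb r l d (s₁.arr 3) (s₁.arr 4) (s₁.arr 2) (s₁.reg 7)
      (s₁.reg 8) 0 := by
    rw [r7, r8, a2, a4]
    refine ⟨by omega, by omega, a3, ?_, ?_, ?_, ?_, ?_, ?_, ?_, ?_, ?_, ?_⟩
    · intro i hi
      obtain rfl : i = 0 := by omega
      rw [a3]; exact P.root_lt
    · intro i hi k hk _; omega
    · intro i hi
      obtain rfl : i = 0 := by omega
      rw [a3, Function.update_self, P.root_dist]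
    · intro w hw
      by_cases hwr : w = r
      · exact ⟨0, by omega, by rw [a3, hwr]⟩
      · rw [Function.update_of_ne hwr] at hw
        exact absurd (hdist w) hw
    · intro i k hik hk
      obtain rfl : i = k := by omega
      exact le_rfl
    · intro _ k hk
      obtain rfl : k = 0 := by omega
      omega
    · intro w hw i hi
      obtain ⟨hih, rfl⟩ := (hlab w i).1 hi
      exact P.root_neighbor i hih
    · exact fun i hi => (hlab _ i).2 ⟨hi, rfl⟩
    · intro i hi; omega
    · intro k _ hk; omega
  -- Each vertex has a budget `f` proportional to its degree plus one, and the potential is what the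
  -- processed vertices have left over. Since queue entries are distinct, `sum_queue_le` shows that
  -- the subtraction does not truncate.
  refine Runs.loop (fun s' => s'.arr 0 = st ∧ s'.arr 1 = nb ∧ s'.reg 0 = n ∧
      s'.reg 1 = s.reg 1 ∧ s'.reg 6 = s.reg 6 ∧
      SearchInv n h st nb r l d (s'.arr 3) (s'.arr 4) (s'.arr 2) (s'.reg 7) (s'.reg 8) 0)
    (fun s' => 100 * st n + 100 * n - ∑ i ∈ Finset.range (s'.reg 7), f (s'.arr 3 i))
    ⟨a0, a1, r0, r1, r6, Istart⟩ (by simp [Expr.cost, r7]) ?_ ?_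
  · rintro s₂ ⟨a0, a1, r0, r1, r6, I⟩ he
    have hlt : s₂.reg 7 < s₂.reg 8 := (eval_lt_ne_zero L.one_lt _ _).1 he
    refine ⟨_, (runs_searchBody L P hh hhW a0 a1 I hlt).mono le_rfl ?_⟩
    rintro s₃ ⟨b0, b1, q0, q1, q6, q7, I₃, hq⟩
    refine ⟨⟨b0, b1, q0.trans r0, q1.trans r1, q6.trans r6, I₃⟩, ?_⟩
    have hsum : ∑ i ∈ Finset.range (s₃.reg 7), f (s₃.arr 3 i) =
        ∑ i ∈ Finset.range (s₂.reg 7 + 1), f (s₂.arr 3 i) := by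
      rw [q7]
      refine Finset.sum_congr rfl fun i hi => ?_
      rw [hq i (by have := Finset.mem_range.1 hi; omega)]
    have hle : ∑ i ∈ Finset.range (s₂.reg 7 + 1), f (s₂.arr 3 i) ≤ 100 * st n + 100 * n := by
      rw [← htotal]
      exact sum_queue_le (fun i hi => I.queue_lt i (by omega))
        (fun i hi j hj => I.queue_inj i (by omega) j (by omega)) f
    rw [hsum]
    rw [Finset.sum_range_succ] at hle ⊢
    have hf : f (s₂.arr 3 (s₂.reg 7)) = 100 * (st (s₂.arr 3 (s₂.reg 7) + 1) -
        st (s₂.arr 3 (s₂.reg 7))) + 100 := rfl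
    simp only [Expr.cost]
    omega
  · rintro s₂ ⟨a0, a1, r0, r1, r6, I⟩ he
    have hge : s₂.reg 8 ≤ s₂.reg 7 := by
      by_contra hne
      refine (eval_lt_ne_zero L.one_lt _ _).2 ?_ he
      simp only [Expr.eval]; omega
    exact ⟨a0, a1, r0, r1, r6, I.lab_eq P hge⟩

end DaisyCube

namespace DaisyCube

/-! ### Reading the input; vertex and edge counts. -/

section Input

variable {n : ℕ} {G : SimpleGraph (Fin n)} {s : State}

theorem IsInput.adj_iff_lists (hs : IsInput G s) (u w : Fin n) :
    G.Adj u w ↔ Lists (s.arr 0) (s.arr 1) u w := by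
  constructor
  · intro h
    obtain ⟨j, hj, hjw⟩ := (hs.neighbors u).surjOn ⟨w, h, rfl⟩
    exact ⟨j, hj.1, hj.2, hjw⟩
  · rintro ⟨j, hj, hj', hjw⟩
    obtain ⟨x, hx, hxw⟩ := (hs.neighbors u).mapsTo ⟨hj, hj'⟩
    rw [hjw] at hxw
    rw [← Fin.ext hxw]; exact hx

theorem IsInput.lists_lt (hs : IsInput G s) (u : Fin n) (w : ℕ)
    (h : Lists (s.arr 0) (s.arr 1) u w) : w < n := by
  obtain ⟨j, hj, hj', rfl⟩ := h
  obtain ⟨x, -, hx⟩ := (hs.neighbors u).mapsTo ⟨hj, hj'⟩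
  rw [← hx]; exact x.2

theorem IsInput.adjLists (hs : IsInput G s) : AdjLists n (s.arr 0) (s.arr 1) where
  start_zero := hs.start_zero
  start_mono v hv := hs.start_mono ⟨v, hv⟩
  entry_lt v hv j hj hj' := hs.lists_lt ⟨v, hv⟩ _ ⟨j, hj, hj', rfl⟩

theorem IsInput.ncard_neighborSet (hs : IsInput G s) (v : Fin n) :
    (G.neighborSet v).ncard = s.arr 0 (v + 1) - s.arr 0 v := by
  rw [← Set.ncard_image_of_injective _ Fin.val_injective, ← (hs.neighbors v).ncard_eq,
    Set.ncard_eq_toFinset_card']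
  simp

/-- The list lengths telescope to the last row start, and the degree sum is twice the number of
edges. -/
theorem IsInput.start_last (hs : IsInput G s) : s.arr 0 n = 2 * G.edgeSet.ncard := by
  classical
  have h1 := hs.adjLists.sum_degree 1 0 n le_rfl
  have h2 := G.sum_degrees_eq_twice_card_edges
  rw [Set.ncard_eq_toFinset_card', ← SimpleGraph.edgeFinset, ← h2]
  simp only [one_mul, add_zero, zero_mul] at h1
  rw [← h1, Finset.sum_range]
  refine Finset.sum_congr rfl fun v _ => ?_
  rw [← hs.ncard_neighborSet, Set.ncard_eq_toFinset_card',
    ← SimpleGraph.card_neighborFinset_eq_degree]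
  congr

end Input

/-! ### The complete program and its correctness. -/

/-- Computes a proper embedding of a daisy cube given by adjacency lists. -/
def embed : Prog :=
  .cond (.reg 0) (.seq maxDegree (.seq labelRoot (.seq search (.seq missing invert)))) .skip

theorem isProperEmbedding_of_isEmpty {V : Type*} [IsEmpty V] {G : SimpleGraph V} {h : ℕ}
    (α : V → Fin h → Bool) : IsProperEmbedding G α :=
  IsDaisyLabelling.isProperEmbedding
    ⟨Function.injective_of_subsingleton α, fun u => isEmptyElim u, by
      rw [Set.range_eq_empty]; exact isLowerSet_empty⟩

variable {n h : ℕ} {G : SimpleGraph (Fin n)} {s : State}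

/-- A vertex of degree `h` can be joined to its neighbours, in the order of its list, by the `h`
directions of a daisy labelling. -/
theorem exists_isDaisyLabelling_root {y : Fin n → Fin h → Bool} (hy : IsDaisyLabelling G y)
    (hs : IsInput G s) (r : Fin n) (hdeg : s.arr 0 (r + 1) = s.arr 0 r + h) :
    ∃ y' : Fin n → Fin h → Bool, IsDaisyLabelling G y' ∧
      ∀ i : Fin h, ∃ w : Fin n, s.arr 1 (s.arr 0 r + i) = w ∧ y' w = flipAt (y' r) i := by
  have hex : ∀ i : Fin h, ∃ (w : Fin n) (c : Fin h), s.arr 1 (s.arr 0 r + i) = w ∧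
      y w = flipAt (y r) c := by
    intro i
    have hl : Lists (s.arr 0) (s.arr 1) r (s.arr 1 (s.arr 0 r + i)) :=
      ⟨_, by omega, by omega, rfl⟩
    have hw := hs.lists_lt r _ hl
    obtain ⟨c, hc⟩ := hy.exists_eq_flipAt ((hs.adj_iff_lists r ⟨_, hw⟩).2 hl)
    exact ⟨⟨_, hw⟩, c, rfl, hc⟩
  choose w c hw hc using hex
  have hci : Function.Injective c := by
    intro i j hij
    have hwij : w i = w j := hy.injective (by rw [hc, hc, hij])
    have := (hs.neighbors r).injOn (x₁ := s.arr 0 r + i) (x₂ := s.arr 0 r + j)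
      ⟨by omega, by omega⟩ ⟨by omega, by omega⟩ (by rw [hw, hw, hwij])
    exact Fin.ext (by omega)
  -- The degree equals the number of coordinates, so `c` is a permutation and reindexing loses
  -- nothing.
  have hcs : Function.Surjective c := Finite.surjective_of_injective hci
  refine ⟨_, hy.reindex c hci fun v i _ => hcs i, fun i => ⟨w i, hw i, funext fun k => ?_⟩⟩
  rw [hc]
  by_cases hki : k = i
  · subst hki; rw [flipAt_self, flipAt_self]
  · rw [flipAt_of_ne _ hki, flipAt_of_ne _ (hci.ne hki)]

theorem runs_embed {W : ℕ} (hG : IsDaisyCube G) (hh : IsIsometricDimension G h) (hW : h ≤ W)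
    (hK : 4 * (n + G.edgeSet.ncard + 1) ≤ 2 ^ W) (hs : IsInput G s) :
    Runs W embed s (2000 * (G.edgeSet.ncard + 1)) fun s' =>
      s'.reg 1 = h ∧ (∀ v : Fin n, s'.arr 2 v < 2 ^ h) ∧
      IsProperEmbedding G (outputLabel n h s') := by
  rcases Nat.eq_zero_or_pos n with rfl | hn
  · refine ⟨_, s, .condFalse (by simp [Expr.eval, hs.reg_zero]) (.skip s),
      by simp [Expr.cost]; omega, ?_, fun v => v.elim0, isProperEmbedding_of_isEmpty _⟩
    -- The graph without vertices embeds in the `0`-cube, and the untouched register `1` already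
    -- holds `0`.
    rw [hs.reg_other 1 one_ne_zero]
    have : h ≤ 0 := hh.2 ⟨fun v => v.elim0, fun u => u.elim0⟩
    omega
  have : Nonempty (Fin n) := ⟨⟨0, hn⟩⟩
  obtain ⟨y₀, hy₀, ⟨v₀, f₀, hf₀, hv₀⟩, hmax⟩ :=
    exists_isDaisyLabelling_of_isIsometricDimension hG hh
  have hnm : n ≤ G.edgeSet.ncard + 1 := by
    have hc : G.Connected := ⟨fun u v => by
      obtain ⟨p, -⟩ := hy₀.exists_walk _ u v rfl
      exact p.reachable⟩
    simpa using hc.card_vert_le_card_edgeSet_add_one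
  have hlast := hs.start_last
  have hdeg₀ : h ≤ s.arr 0 (v₀ + 1) - s.arr 0 v₀ := by
    have := Set.ncard_le_ncard (s := Set.range f₀) (t := G.neighborSet v₀)
      (by rintro _ ⟨k, rfl⟩; exact hv₀ k)
    rwa [Set.ncard_range_of_injective hf₀, Nat.card_fin, hs.ncard_neighborSet] at this
  have L : WordLists W n (s.arr 0) (s.arr 1) :=
    { hs.adjLists with one_lt := by omega, size_lt := by omega, start_lt := by omega }
  suffices H : Runs W (.seq maxDegree (.seq labelRoot (.seq search (.seq missing invert)))) s
      ((100 * n + 100) + ((100 * h + 100) + ((100 * s.arr 0 n + 100 * n + 50) +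
        ((50 * s.arr 0 n + 200 * n + 50) + (50 * n + 50))))) fun s' =>
      s'.reg 1 = h ∧ (∀ v : Fin n, s'.arr 2 v < 2 ^ h) ∧
      IsProperEmbedding G (outputLabel n h s') by
    obtain ⟨t, s', he, ht, hQ⟩ := H
    refine ⟨_, s', .condTrue (by simp [Expr.eval, hs.reg_zero]; omega) he, ?_, hQ⟩
    -- As a degree, `h` is at most the total list length `2 * m`; with `n ≤ m + 1` the sum of the
    -- phases becomes linear in `m + 1`.
    have hle : h ≤ s.arr 0 n := by
      have := L.start_le (v := v₀ + 1) v₀.2 le_rfl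
      omega
    simp only [Expr.cost]
    omega
  refine Runs.seq (runs_maxDegree L hn hs.reg_zero rfl) ?_
  rintro s₁ ⟨ha₁, h0₁, h2₁, hdeg₁, hmax₁⟩
  have hdeg' : s.arr 0 (s₁.reg 2 + 1) = s.arr 0 (s₁.reg 2) + s₁.reg 1 := by
    have := L.start_mono _ h2₁
    omega
  have h1₁ : s₁.reg 1 = h := by
    apply le_antisymm
    · have hl : ∀ k : Fin (s₁.reg 1), Lists (s.arr 0) (s.arr 1) (s₁.reg 2)
          (s.arr 1 (s.arr 0 (s₁.reg 2) + k)) := fun k => ⟨_, by omega, by omega, rfl⟩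
      refine hmax ⟨_, h2₁⟩ _ (fun k => ⟨_, hs.lists_lt ⟨_, h2₁⟩ _ (hl k)⟩) ?_ ?_
      · intro i j hij
        have := (hs.neighbors ⟨_, h2₁⟩).injOn (x₁ := s.arr 0 (s₁.reg 2) + i)
          (x₂ := s.arr 0 (s₁.reg 2) + j) ⟨by simp, by simp only; omega⟩
          ⟨by simp, by simp only; omega⟩ (congrArg Fin.val hij)
        exact Fin.ext (by omega)
      · exact fun k => (hs.adj_iff_lists _ _).2 (hl k)
    · exact hdeg₀.trans (hmax₁ v₀ v₀.2)
  rw [h1₁] at hdeg'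
  obtain ⟨r, hr⟩ : ∃ r : Fin n, (r : ℕ) = s₁.reg 2 := ⟨⟨_, h2₁⟩, rfl⟩
  rw [← hr] at hdeg'
  obtain ⟨y, hy, hroot⟩ := exists_isDaisyLabelling_root hy₀ hs r hdeg'
  have P := hy.propagates hs.adj_iff_lists hs.lists_lt r hroot
  -- Distances are at most `h`, are stored plus one, and are increased once more when a neighbour is
  -- examined.
  have hhW : h + 2 < 2 ^ W := by
    have := L.start_le (v := r + 1) r.2 le_rfl
    omega
  have hpow : 2 ^ h ≤ 2 ^ W := Nat.pow_le_pow_right two_pos hW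
  refine Runs.seq (runs_labelRoot L r.2 hW hdeg' h0₁ h1₁ hr.symm (by rw [ha₁]) (by rw [ha₁])
    fun w => by rw [ha₁, hs.arr_other 2 w le_rfl]) ?_
  rintro s₂ ⟨ha₂, h0₂, h1₂, h2₂, h6₂, hl₂⟩
  refine Runs.seq (runs_search L P hW hhW (by rw [ha₂ 0 (by simp), ha₁])
    (by rw [ha₂ 1 (by simp), ha₁]) h0₂ h2₂
    (fun w => by rw [ha₂ 4 (by simp), ha₁, hs.arr_other 4 w (by simp)]) hl₂) ?_
  rintro s₃ ⟨ha0₃, ha1₃, h0₃, h1₃, h6₃, hl₃⟩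
  refine Runs.seq (runs_missing L hW P.label_lt h0₃ ha0₃ ha1₃ hl₃ (by rw [h6₃]; exact h6₂)) ?_
  rintro s₄ ⟨ha₄, h0₄, h1₄, hB⟩
  have hBlt : s₄.reg 11 < 2 ^ h := by
    apply Nat.lt_pow_two_of_testBit
    intro i hi
    by_contra hb
    obtain ⟨w, hw, hwi, -⟩ := (hB i).1 (by simpa using hb)
    have := lt_of_testBit (P.label_lt w hw) hwi
    omega
  refine (runs_invert L.size_lt (hBlt.trans_le hpow) (fun w hw => (P.label_lt w hw).trans_le hpow)
    h0₄ rfl (by rw [ha₄]; exact hl₃)).mono le_rfl ?_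
  rintro s₅ ⟨h1₅, hl₅⟩
  refine ⟨by rw [h1₅, h1₄, h1₃, h1₂], fun v => ?_, ?_⟩
  · rw [hl₅ v v.2]; exact Nat.xor_lt_two_pow (P.label_lt v v.2) hBlt
  · have hfin := hy.recenter_relLabel hs.adj_iff_lists hs.lists_lt r (s₄.reg 11) fun i _ => hB i
    have heq : outputLabel n h s₅ =
        fun (v : Fin n) (i : Fin h) => (relLabel y r v ^^^ s₄.reg 11).testBit i := by
      funext v i
      simp only [outputLabel, hl₅ v v.2]
    rw [heq]
    exact hfin.isProperEmbedding

end DaisyCube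

/-- One program finds, for every graph isomorphic to a daisy cube given by adjacency lists, its
isometric dimension `h` (in register `1`) and a proper embedding into the `h`-cube (in array `2`),
within a number of steps linear in the number of edges. A machine word holds a label (`h ≤ W`)
and a number of size linear in the input. -/
theorem theorem5p5 :
    ∃ (P : DaisyCube.Prog) (C K : ℕ),
      ∀ (n : ℕ) (G : SimpleGraph (Fin n)) (h W : ℕ) (s : DaisyCube.State),
        DaisyCube.IsDaisyCube G →
        DaisyCube.IsIsometricDimension G h →
        h ≤ W → K * (n + G.edgeSet.ncard + 1) ≤ 2 ^ W →
        DaisyCube.IsInput G s →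
        ∃ (t : ℕ) (s' : DaisyCube.State),
          DaisyCube.Exec W P s t s' ∧
          t ≤ C * (G.edgeSet.ncard + 1) ∧
          s'.reg 1 = h ∧
          (∀ v : Fin n, s'.arr 2 v < 2 ^ h) ∧
          DaisyCube.IsProperEmbedding G (DaisyCube.outputLabel n h s') :=
  ⟨DaisyCube.embed, 2000, 4, fun _ _ _ _ _ hG hh hW hK hs =>
    DaisyCube.runs_embed hG hh hW hK hs⟩
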